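/- **Proposition (asymptotics of the scattering matrix).** Let $\alpha>0$, $u_0>0$, $u_\pm\in\mathbb C$ with $|u_\pm|=u_0$, and fix a time $t$. Let $u(\cdot,t):\mathbb R\to\mathbb C$ be continuously differentiable with $u(x,t)\to u_\pm$ as $x\to\pm\infty$, $u(\cdot,t)-u_-\in L^1(-\infty,0)$, $u(\cdot,t)-u_+\in L^1(0,\infty)$ and $u_x(\cdot,t)\in L^1(\mathbb R)$ (for example, $u(\cdot,t)$ may be the profile at time $t$ of a solution of the modified NLS equation $iu_t+u_{xx}+4i\alpha u_x+\frac{i}{\alpha}(|u|^2u)_x=0$). For $z\ne0$ put $k=\frac1{2\alpha}\left(z-\frac{u_0^2}{z}\right)$, $\lambda=\frac12\left(z+\frac{u_0^2}{z}\right)$, $\theta=-k\lambda\left[x+\left(2\alpha k^2-4\alpha-\frac{u_0^2}{\alpha}\right)t\right]$, $\gamma=1+\frac{u_0^2}{z^2}$, and $$\sigma_3=\begin{pmatrix}1&0\\0&-1\end{pmatrix},\quad Q=\begin{pmatrix}0&u\\ u^*&0\end{pmatrix},\quad Q_\pm=\begin{pmatrix}0&u_\pm\\ u_\pm^*&0\end{pmatrix},\quad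 X=-i\alpha k^2\sigma_3+ikQ,\quad Y_\pm=I+\frac1z\sigma_3Q_\pm .$$ Let $\Sigma=(\mathbb R\cup i\mathbb R)\setminus\{0\}$, $D^+=\{\operatorname{Re}z\operatorname{Im}z<0\}$, $D^-=\{\operatorname{Re}z\operatorname{Im}z>0\}$. The Jost solutions $\phi_\pm=(\phi_{\pm,1},\phi_{\pm,2})$ are the solutions of $\phi_x=X\phi$ with $\phi_\pm e^{-i\theta\sigma_3}\to Y_\pm$ as $x\to\pm\infty$. Away from $z=\pm iu_0$, both columns exist for $z\in\Sigma$, while $\phi_{+,1},\phi_{-,2}$ exist for $z\in D^+\cup\Sigma$ and $\phi_{-,1},\phi_{+,2}$ for $z\in D^-\cup\Sigma$. The scattering matrix $S(z)=(s_{ij}(z))$ is defined for $z\in\Sigma\setminus\{\pm iu_0\}$ by $\phi_+=\phi_-S(z)$ for all $x\in\mathbb R$. For all $x$ and all such $z$ its diagonal entries are $$s_{11}=\frac{\det(\phi_{+,1},\phi_{-,2})}{\gamma},\qquad s_{22}=\frac{\det(\phi_{-,1},\phi_{+,2})}{\gamma},$$ and these formulas define $s_{11}$ on $D^+\cup\Sigma$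 and $s_{22}$ on $D^-\cup\Sigma$ (except at $\pm iu_0$). Then $u_0^2-|u(\cdot,t)|^2$ is integrable on $\mathbb R$ and, with $$\nu_0=\frac1{2\alpha}\int_{-\infty}^{+\infty}\left(u_0^2-|u(y,t)|^2\right)dy,$$ one has, for $z\in\Sigma$, $$S(z)=e^{-i\nu_0\sigma_3}+O(z^{-1})\quad(z\to\infty),\qquad S(z)=\operatorname{diag}\left(\frac{u_-}{u_+},\frac{u_+}{u_-}\right)e^{i\nu_0\sigma_3}+O(z)\quad(z\to0).$$ Moreover the resulting asymptotics of the diagonal entries hold in the full regions: $s_{11}(z)=e^{-i\nu_0}+O(z^{-1})$ as $z\to\infty$ and $s_{11}(z)=\frac{u_-}{u_+}e^{i\nu_0}+O(z)$ as $z\to0$, for $z\in D^+\cup\Sigma$; and $s_{22}(z)=e^{i\nu_0}+O(z^{-1})$ as $z\to\infty$ and $s_{22}(z)=\frac{u_+}{u_-}e^{-i\nu_0}+O(z)$ as $z\to0$, for $z\in D^-\cup\Sigma$. -/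

import Mathlib

open Complex Filter Topology MeasureTheory Matrix

namespace MNLS

/-- `k(z) = (z - u₀² / z) / (2α)`. -/
noncomputable def specK (α u₀ : ℝ) (z : ℂ) : ℂ := (z - (u₀ : ℂ) ^ 2 / z) / (2 * (α : ℂ))

/-- `λ(z) = (z + u₀² / z) / 2`. -/
noncomputable def specLam (u₀ : ℝ) (z : ℂ) : ℂ := (z + (u₀ : ℂ) ^ 2 / z) / 2

/-- The phase `θ(x,t,z) = -k λ (x + (2 α k² - 4 α - u₀² / α) t)`. -/
noncomputable def phase (α u₀ x t : ℝ) (z : ℂ) : ℂ :=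
  -(specK α u₀ z * specLam u₀ z *
    ((x : ℂ) + (2 * (α : ℂ) * specK α u₀ z ^ 2 - 4 * (α : ℂ) - (u₀ : ℂ) ^ 2 / (α : ℂ)) * (t : ℂ)))

/-- The Pauli matrix `σ₃`. -/
def sigma3 : Matrix (Fin 2) (Fin 2) ℂ := !![1, 0; 0, -1]

/-- The matrix exponential `e^{a σ₃} = diag(e^a, e^{-a})`. -/
noncomputable def expSigma3 (a : ℂ) : Matrix (Fin 2) (Fin 2) ℂ := !![exp a, 0; 0, exp (-a)]

/-- The off-diagonal matrix `Q` built from the value `w` of the potential. -/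
noncomputable def potQ (w : ℂ) : Matrix (Fin 2) (Fin 2) ℂ := !![0, w; starRingEnd ℂ w, 0]

/-- The matrix `X = -i α k² σ₃ + i k Q` of the spatial part of the Lax pair, at a point where the
potential has the value `w`. -/
noncomputable def laxX (α u₀ : ℝ) (z w : ℂ) : Matrix (Fin 2) (Fin 2) ℂ :=
  (-(I * (α : ℂ) * specK α u₀ z ^ 2)) • sigma3 + (I * specK α u₀ z) • potQ w

/-- The eigenvector matrix `Y = I + z⁻¹ σ₃ Q` of `X` at a boundary value `v` of the potential. -/
noncomputable def eigY (z v : ℂ) : Matrix (Fin 2) (Fin 2) ℂ := 1 + z⁻¹ • (sigma3 * potQ v)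

/-- `γ(z) = det Y = 1 + u₀² / z²`. -/
noncomputable def gam (u₀ : ℝ) (z : ℂ) : ℂ := 1 + (u₀ : ℂ) ^ 2 / z ^ 2

/-- The contour `Σ = (ℝ ∪ iℝ) \ {0}`. -/
def contour : Set ℂ := {z | z.re * z.im = 0 ∧ z ≠ 0}

/-- The open region `D⁺`. -/
def Dplus : Set ℂ := {z | z.re * z.im < 0}

/-- The open region `D⁻`. -/
def Dminus : Set ℂ := {z | 0 < z.re * z.im}

/-- `φ` is, at time `t`, the `j`-th column of the Jost solution `φ ∼ Y e^{iθσ₃}` normalised at the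
end `l` of the line (`atTop` or `atBot`), where the potential has the boundary value `v`: it solves
`φ_x = X φ`, and the `j`-th column of `φ e^{-iθσ₃}` tends to that of `Y`. -/
def IsJostColumn (l : Filter ℝ) (v : ℂ) (α u₀ : ℝ) (u : ℝ → ℝ → ℂ) (j : Fin 2) (t : ℝ) (z : ℂ)
    (φ : ℝ → Fin 2 → ℂ) : Prop :=
  (∀ x, HasDerivAt φ (laxX α u₀ z (u x t) *ᵥ φ x) x) ∧
    Tendsto (fun x => expSigma3 (-(I * phase α u₀ x t z)) j j • φ x) l
      (𝓝 (fun i => eigY z v i j))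

open Classical in
/-- The `j`-th Jost column (the zero function if there is none). -/
noncomputable def jostColumn (l : Filter ℝ) (v : ℂ) (α u₀ : ℝ) (u : ℝ → ℝ → ℂ) (j : Fin 2)
    (x t : ℝ) (z : ℂ) : Fin 2 → ℂ :=
  if h : ∃ φ, IsJostColumn l v α u₀ u j t z φ then h.choose x else 0

/-- The Jost solution `φ₊ = (φ₊,₁, φ₊,₂)` if `(l, v) = (atTop, u₊)`, and
`φ₋ = (φ₋,₁, φ₋,₂)` if `(l, v) = (atBot, u₋)`. -/
noncomputable def jost (l : Filter ℝ) (v : ℂ) (α u₀ : ℝ) (u : ℝ → ℝ → ℂ) (x t : ℝ) (z : ℂ) :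
    Matrix (Fin 2) (Fin 2) ℂ :=
  Matrix.of fun i j => jostColumn l v α u₀ u j x t z i

open Classical in
/-- The scattering matrix: the matrix `S` with `φ₊ = φ₋ S` on the whole line (zero if there is
none). -/
noncomputable def scatteringMatrix (α u₀ : ℝ) (um up : ℂ) (u : ℝ → ℝ → ℂ) (t : ℝ) (z : ℂ) :
    Matrix (Fin 2) (Fin 2) ℂ :=
  if h : ∃ S : Matrix (Fin 2) (Fin 2) ℂ,
      ∀ x, jost atTop up α u₀ u x t z = jost atBot um α u₀ u x t z * S
  then h.choose else 0

/-- The Wronskian of two vectors. -/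
def wronskian (a b : Fin 2 → ℂ) : ℂ := a 0 * b 1 - a 1 * b 0

/-- The entry `s₁₁ = Wr(φ₊,₁, φ₋,₂) / γ`, on `D⁺` and its boundary `Σ`. The Wronskian of two
solutions does not depend on the point `x`, since `X` has trace zero. -/
noncomputable def s11 (α u₀ : ℝ) (um up : ℂ) (u : ℝ → ℝ → ℂ) (x t : ℝ) (z : ℂ) : ℂ :=
  wronskian (jostColumn atTop up α u₀ u 0 x t z) (jostColumn atBot um α u₀ u 1 x t z) / gam u₀ z

/-- The entry `s₂₂ = Wr(φ₋,₁, φ₊,₂) / γ`, on `D⁻` and its boundary `Σ`. -/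
noncomputable def s22 (α u₀ : ℝ) (um up : ℂ) (u : ℝ → ℝ → ℂ) (x t : ℝ) (z : ℂ) : ℂ :=
  wronskian (jostColumn atBot um α u₀ u 0 x t z) (jostColumn atTop up α u₀ u 1 x t z) / gam u₀ z

/-- `ν₀ = (1 / 2α) ∫ (u₀² - |u|²) dy`. -/
noncomputable def nu0 (α u₀ : ℝ) (u : ℝ → ℝ → ℂ) (t : ℝ) : ℝ :=
  1 / (2 * α) * ∫ y : ℝ, (u₀ ^ 2 - ‖u y t‖ ^ 2)

end MNLS

open scoped BoundedContinuousFunction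

namespace MNLS

/-! Since `X` has trace zero, Wronskians of solutions are constant in `x`, and `det φ₋ = γ`. By
Cramer's rule every entry of `S` is a Wronskian of two Jost columns divided by `γ`. It remains to
find the columns for large and for small `z`.

Large `z`, column `φ₊,₁`: put `s = ū/z` and `B = u/(2λ)`, formed with `u(x)` itself and not with its
boundary value. The unknowns `ψ = φ₂ + sφ₁` and `χ = φ₁ - Bψ` diagonalize the system
(`hasDerivAt_diagonalized`) up to a diagonal term `±i(k/z)(u₀² - |u|²)` and remainders that are
`O(1/z)` times integrable functions of `x`; this is where `u_x ∈ L¹` enters. As `k/z → 1/(2α)`, the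
diagonal term survives in the limit and integrates to the phase `e^{-i tailPhase}`. The remainders
are absorbed by `norm_sub_one_le_of_perturbation`, uniformly in `x`, whenever `Re(2ikλ) ≥ 0`, which
is the case on `D⁺ ∪ Σ`. The column normalised at `-∞` carries the complementary phase, and the two
phases add up to `ν₀`.

The rest is symmetry. The reflection `x ↦ -x` exchanges the two ends, `z ↦ -z̄` exchanges the two
columns and the regions `D⁺`, `D⁻`, and `z ↦ -u₀²/z` carries `z → 0` to `z → ∞`; the factors `u₋/u₊`
and `u₊/u₋` come from the scalars in this last symmetry. The off-diagonal Wronskians contain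
`e^{±2iθ}`, which is bounded because `θ` is real on `Σ`.

Existence of the columns comes from a Volterra equation (`exists_solution_tendsto`). All estimates
hold for every function with the defining properties of a Jost column, so the choice made in
`jostColumn` is harmless and uniqueness is not needed. -/

/-! ### Integrals over half-lines and perturbation estimates from `+∞`. -/

theorem hasDerivAt_integral_Ioi {E : Type*} [NormedAddCommGroup E] [NormedSpace ℝ E]
    [CompleteSpace E] {f : ℝ → E} (hf : Continuous f) (hint : ∀ a, IntegrableOn f (Set.Ioi a))
    (x : ℝ) : HasDerivAt (fun x => ∫ y in Set.Ioi x, f y) (-f x) x := by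
  have h : (fun x => ∫ y in Set.Ioi x, f y)
      = fun x => (∫ y in Set.Ioi (0 : ℝ), f y) - ∫ y in (0 : ℝ)..x, f y := by
    funext x
    rw [eq_sub_iff_add_eq, add_comm]
    exact intervalIntegral.integral_interval_add_Ioi (hint 0) (hint x)
  rw [h]
  simpa using (hf.integral_hasStrictDerivAt 0 x).hasDerivAt.const_sub (∫ y in Set.Ioi (0 : ℝ), f y)

theorem tendsto_integral_Ioi_atTop {E : Type*} [NormedAddCommGroup E] [NormedSpace ℝ E]
    [CompleteSpace E] {f : ℝ → E} (hint : ∀ a, IntegrableOn f (Set.Ioi a)) :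
    Tendsto (fun x => ∫ y in Set.Ioi x, f y) atTop (𝓝 0) := by
  have h : (fun x => ∫ y in Set.Ioi x, f y)
      = fun x => (∫ y in Set.Ioi (0 : ℝ), f y) - ∫ y in (0 : ℝ)..x, f y := by
    funext x
    rw [eq_sub_iff_add_eq, add_comm]
    exact intervalIntegral.integral_interval_add_Ioi (hint 0) (hint x)
  rw [h]
  simpa using (intervalIntegral_tendsto_integral_Ioi 0 (hint 0) tendsto_id).const_sub
    (∫ y in Set.Ioi (0 : ℝ), f y)

/-- A function with a limit at infinity and a derivative dominated by an integrable function stays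
close to its limit. -/
theorem norm_sub_le_integral_Ioi {c c' : ℝ → ℂ} {β : ℝ → ℝ} {l : ℂ} {y : ℝ}
    (hβ : IntegrableOn β (Set.Ioi y)) (hc : ∀ x, HasDerivAt c (c' x) x)
    (hlim : Tendsto c atTop (𝓝 l)) (hbound : ∀ s, y < s → ‖c' s‖ ≤ β s) :
    ‖c y - l‖ ≤ ∫ s in Set.Ioi y, β s := by
  have hc' : c' = deriv c := funext fun x => (hc x).deriv.symm
  have hint : IntegrableOn c' (Set.Ioi y) := by
    refine Integrable.mono' hβ ?_ ?_
    · rw [hc']; exact aestronglyMeasurable_deriv c _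
    · filter_upwards [ae_restrict_mem measurableSet_Ioi] with s hs using hbound s hs
  have h := integral_Ioi_of_hasDerivAt_of_tendsto' (fun x _ => hc x) hint hlim
  rw [norm_sub_rev, ← h]
  refine norm_integral_le_of_norm_le hβ ?_
  filter_upwards [ae_restrict_mem measurableSet_Ioi] with s hs using hbound s hs

/-- The version of `norm_sub_le_integral_Ioi` for an equation with a growing linear part. -/
theorem norm_le_integral_Ioi_of_linear {b g : ℝ → ℂ} {β : ℝ → ℝ} {μ : ℂ} {y : ℝ}
    (hμ : 0 ≤ μ.re) (hβ : IntegrableOn β (Set.Ioi y))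
    (hb : ∀ x, HasDerivAt b (μ * b x + g x) x) (hlim : Tendsto b atTop (𝓝 0))
    (hbound : ∀ s, y < s → ‖g s‖ ≤ β s) :
    ‖b y‖ ≤ ∫ s in Set.Ioi y, β s := by
  -- The integrating factor `e^{μ(y - s)}` removes the linear part. It equals 1 at `s = y` and is at
  -- most 1 in modulus for `s ≥ y`, because `Re μ ≥ 0`.
  have hexp : ∀ s, y ≤ s → ‖exp (μ * ((y : ℂ) - s))‖ ≤ 1 := by
    intro s hs
    rw [norm_exp, Real.exp_le_one_iff]
    simp only [mul_re, sub_re, ofReal_re, sub_im, ofReal_im, sub_self, mul_zero, sub_zero]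
    exact mul_nonpos_of_nonneg_of_nonpos hμ (by linarith)
  have hc : ∀ x : ℝ, HasDerivAt (fun s : ℝ => exp (μ * ((y : ℂ) - s)) * b s)
      (exp (μ * ((y : ℂ) - x)) * g x) x := by
    intro x
    have h1 : HasDerivAt (fun s : ℝ => μ * ((y : ℂ) - s)) (μ * (-1)) x :=
      ((hasDerivAt_id x).ofReal_comp.const_sub (y : ℂ)).const_mul μ
    refine (h1.cexp.mul (hb x)).congr_deriv ?_
    ring
  have h := norm_sub_le_integral_Ioi (c := fun s : ℝ => exp (μ * ((y : ℂ) - s)) * b s)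
    (l := 0) hβ hc ?_ ?_
  · simpa using h
  · refine squeeze_zero_norm' (a := fun s => ‖b s‖) ?_ (by simpa using hlim.norm)
    filter_upwards [eventually_ge_atTop y] with s hs
    rw [norm_mul]
    exact mul_le_of_le_one_left (norm_nonneg _) (hexp s hs)
  · intro s hs
    rw [norm_mul]
    exact (mul_le_of_le_one_left (norm_nonneg _) (hexp s hs.le)).trans (hbound s hs)

theorem bddAbove_norm_Ici {E : Type*} [NormedAddCommGroup E] {a : ℝ → E} (ha : Continuous a)
    {l : E} (hl : Tendsto a atTop (𝓝 l)) (x : ℝ) : ∃ K, ∀ y, x ≤ y → ‖a y‖ ≤ K := by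
  obtain ⟨N, hN⟩ := eventually_atTop.1 (hl.norm.eventually (gt_mem_nhds (lt_add_one ‖l‖)))
  obtain ⟨K, hK⟩ := (isCompact_Icc (a := x) (b := N)).exists_bound_of_continuousOn ha.continuousOn
  refine ⟨max K (‖l‖ + 1), fun y hy => ?_⟩
  rcases le_total y N with h | h
  · exact (hK y ⟨hy, h⟩).trans (le_max_left _ _)
  · exact (hN y h).le.trans (le_max_right _ _)

/-- A small integrable perturbation of the system `a' = 0`, `b' = μ b` with `0 ≤ Re μ`: the
solution that tends to `(1, 0)` at `+∞` is close to `(1, 0)` on the whole line. -/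
theorem norm_sub_one_le_of_perturbation {a b f g : ℝ → ℂ} {μ : ℂ} {β : ℝ → ℝ} (hμ : 0 ≤ μ.re)
    (hβ : Integrable β) (hβ0 : ∀ x, 0 ≤ β x) (ha : ∀ x, HasDerivAt a (f x) x)
    (hb : ∀ x, HasDerivAt b (μ * b x + g x) x)
    (hf : ∀ x, ‖f x‖ ≤ β x * max ‖a x‖ ‖b x‖) (hg : ∀ x, ‖g x‖ ≤ β x * max ‖a x‖ ‖b x‖)
    (ha1 : Tendsto a atTop (𝓝 1)) (hb0 : Tendsto b atTop (𝓝 0)) (hB : ∫ x, β x ≤ 1 / 2) (x : ℝ) :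
    ‖a x - 1‖ ≤ 2 * ∫ x, β x ∧ ‖b x‖ ≤ 2 * ∫ x, β x := by
  -- A bound `S` for the solution on `[x, ∞)` improves itself when fed back into the two integrated
  -- equations.
  have key : ∀ S : ℝ, (∀ y, x ≤ y → max ‖a y‖ ‖b y‖ ≤ S) → ∀ y, x ≤ y →
      ‖a y - 1‖ ≤ S * ∫ x, β x ∧ ‖b y‖ ≤ S * ∫ x, β x := by
    intro S hS y hy
    have hS0 : 0 ≤ S := (norm_nonneg _).trans ((le_max_left _ _).trans (hS x le_rfl))
    have hint : IntegrableOn (fun s => S * β s) (Set.Ioi y) := (hβ.const_mul S).integrableOn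
    have hle : ∫ s in Set.Ioi y, S * β s ≤ S * ∫ x, β x := by
      rw [integral_const_mul]
      exact mul_le_mul_of_nonneg_left
        (setIntegral_le_integral hβ (Eventually.of_forall hβ0)) hS0
    have hbd : ∀ s, y < s → β s * max ‖a s‖ ‖b s‖ ≤ S * β s := by
      intro s hs
      rw [mul_comm]
      exact mul_le_mul_of_nonneg_right (hS s (hy.trans hs.le)) (hβ0 s)
    exact ⟨(norm_sub_le_integral_Ioi hint ha ha1 fun s hs => (hf s).trans (hbd s hs)).trans hle,
      (norm_le_integral_Ioi_of_linear hμ hint hb hb0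
        fun s hs => (hg s).trans (hbd s hs)).trans hle⟩
  have hac : Continuous a := continuous_iff_continuousAt.2 fun x => (ha x).continuousAt
  have hbc : Continuous b := continuous_iff_continuousAt.2 fun x => (hb x).continuousAt
  obtain ⟨K, hK⟩ := bddAbove_norm_Ici hac ha1 x
  obtain ⟨L, hL⟩ := bddAbove_norm_Ici hbc hb0 x
  have hbdd : BddAbove ((fun y => max ‖a y‖ ‖b y‖) '' Set.Ici x) :=
    ⟨max K L, by rintro _ ⟨y, hy, rfl⟩; exact max_le_max (hK y hy) (hL y hy)⟩
  set S := sSup ((fun y => max ‖a y‖ ‖b y‖) '' Set.Ici x)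
  have hS : ∀ y, x ≤ y → max ‖a y‖ ‖b y‖ ≤ S := fun y hy => le_csSup hbdd ⟨y, hy, rfl⟩
  have hI0 : 0 ≤ ∫ x, β x := integral_nonneg hβ0
  have hS0 : 0 ≤ S := (norm_nonneg _).trans ((le_max_left _ _).trans (hS x le_rfl))
  -- The supremum `S` is finite and satisfies `S ≤ 1 + S ∫ β ≤ 1 + S/2`, so the last term can be
  -- absorbed.
  have hS2 : S ≤ 2 := by
    have : S ≤ 1 + S * ∫ x, β x := by
      refine csSup_le (Set.nonempty_Ici.image _) ?_
      rintro _ ⟨y, hy, rfl⟩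
      obtain ⟨h1, h2⟩ := key S hS y hy
      refine max_le ?_ (h2.trans (by linarith))
      calc ‖a y‖ = ‖1 + (a y - 1)‖ := by ring_nf
        _ ≤ 1 + ‖a y - 1‖ := by simpa using norm_add_le (1 : ℂ) (a y - 1)
        _ ≤ _ := by linarith
    nlinarith
  exact key 2 (fun y hy => (hS y hy).trans hS2) x le_rfl

/-! ### Volterra equations with a coefficient integrable at `+∞`. -/

section Existence

variable {ι : Type*} [Fintype ι]

/-- The Volterra operator `w ↦ ∫ₓ^∞ e^{m (x - y)} V(y) w(y) dy`. -/
noncomputable def volterra (m : ι → ℂ) (V : ℝ → Matrix ι ι ℂ) (w : ℝ → ι → ℂ) (x : ℝ) (i : ι) : ℂ :=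
  exp (m i * x) * ∫ y in Set.Ioi x, exp (-(m i * y)) * (V y *ᵥ w y) i

variable {m : ι → ℂ} {V : ℝ → Matrix ι ι ℂ} {β : ℝ → ℝ}

theorem hasDerivAt_integral_Ioi_weight (hβc : Continuous β) (hβ : ∀ a, IntegrableOn β (Set.Ioi a))
    (x : ℝ) : HasDerivAt (fun x => Real.exp (2 * ∫ y in Set.Ioi x, β y))
      (-2 * (β x * Real.exp (2 * ∫ y in Set.Ioi x, β y))) x := by
  refine ((hasDerivAt_integral_Ioi hβc hβ x).const_mul 2).exp.congr_deriv ?_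
  ring

theorem continuous_integral_Ioi_weight (hβc : Continuous β)
    (hβ : ∀ a, IntegrableOn β (Set.Ioi a)) :
    Continuous fun x => Real.exp (2 * ∫ y in Set.Ioi x, β y) :=
  continuous_iff_continuousAt.2 fun x => (hasDerivAt_integral_Ioi_weight hβc hβ x).continuousAt

theorem tendsto_integral_Ioi_weight (hβ : ∀ a, IntegrableOn β (Set.Ioi a)) :
    Tendsto (fun x => Real.exp (2 * ∫ y in Set.Ioi x, β y)) atTop (𝓝 1) := by
  simpa using ((tendsto_integral_Ioi_atTop hβ).const_mul 2).rexp

theorem integrableOn_weight (hβc : Continuous β) (hβ : ∀ a, IntegrableOn β (Set.Ioi a))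
    (hβ0 : ∀ x, 0 ≤ β x) (a : ℝ) :
    IntegrableOn (fun s => β s * Real.exp (2 * ∫ y in Set.Ioi s, β y)) (Set.Ioi a) := by
  refine Integrable.mono' ((hβ a).mul_const (Real.exp (2 * ∫ y in Set.Ioi a, β y)))
    (hβc.mul (continuous_integral_Ioi_weight hβc hβ)).aestronglyMeasurable ?_
  filter_upwards [ae_restrict_mem measurableSet_Ioi] with s hs
  rw [Real.norm_of_nonneg (mul_nonneg (hβ0 s) (Real.exp_pos _).le)]
  refine mul_le_mul_of_nonneg_left (Real.exp_le_exp.2 ?_) (hβ0 s)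
  refine mul_le_mul_of_nonneg_left ?_ zero_le_two
  exact setIntegral_mono_set (hβ a) (Eventually.of_forall hβ0)
    (Set.Ioi_subset_Ioi (le_of_lt hs)).eventuallyLE

/-- The weight `W = exp(2 ∫ₓ^∞ β)` satisfies `W' = -2βW` and tends to 1 at `+∞`. The factor 2 in its
exponent becomes the contraction constant 1/2 of the Volterra operator. -/
theorem integral_Ioi_weight (hβc : Continuous β) (hβ : ∀ a, IntegrableOn β (Set.Ioi a))
    (hβ0 : ∀ x, 0 ≤ β x) (x : ℝ) :
    ∫ s in Set.Ioi x, β s * Real.exp (2 * ∫ y in Set.Ioi s, β y)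
      = (Real.exp (2 * ∫ y in Set.Ioi x, β y) - 1) / 2 := by
  have h := integral_Ioi_of_hasDerivAt_of_tendsto'
    (fun s (_ : s ∈ Set.Ici x) => hasDerivAt_integral_Ioi_weight hβc hβ s)
    ((integrableOn_weight hβc hβ hβ0 x).const_mul (-2)) (tendsto_integral_Ioi_weight hβ)
  rw [integral_const_mul] at h
  linarith

variable (hm : ∀ i, 0 ≤ (m i).re) (hV : Continuous V) (hβc : Continuous β)
  (hβ : ∀ a, IntegrableOn β (Set.Ioi a)) (hβ0 : ∀ x, 0 ≤ β x)
  (hVβ : ∀ x w, ‖V x *ᵥ w‖ ≤ β x * ‖w‖) {w : ℝ → ι → ℂ} {K : ℝ}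

omit [Fintype ι] in
include hm in
theorem norm_exp_neg_le {i : ι} {a y : ℝ} (h : a ≤ y) :
    ‖exp (-(m i * y))‖ ≤ ‖exp (-(m i * a))‖ := by
  rw [norm_exp, norm_exp, Real.exp_le_exp]
  simp only [neg_re, mul_re, ofReal_re, ofReal_im, mul_zero, sub_zero, neg_le_neg_iff]
  exact mul_le_mul_of_nonneg_left h (hm i)

include hVβ hβ0 in
theorem norm_mulVec_apply_le_weight
    (hwK : ∀ x, ‖w x‖ ≤ K * Real.exp (2 * ∫ y in Set.Ioi x, β y)) (y : ℝ) (i : ι) :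
    ‖(V y *ᵥ w y) i‖ ≤ K * (β y * Real.exp (2 * ∫ s in Set.Ioi y, β s)) :=
  calc _ ≤ ‖V y *ᵥ w y‖ := norm_le_pi_norm _ i
    _ ≤ β y * ‖w y‖ := hVβ _ _
    _ ≤ β y * _ := mul_le_mul_of_nonneg_left (hwK y) (hβ0 y)
    _ = _ := by ring

include hV in
theorem continuous_volterra_integrand (hw : Continuous w) (i : ι) :
    Continuous fun y : ℝ => exp (-(m i * y)) * (V y *ᵥ w y) i := by
  have : Continuous fun y => V y *ᵥ w y := hV.matrix_mulVec hw
  fun_prop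

include hm hV hβc hβ hβ0 hVβ in
theorem integrableOn_volterra (hw : Continuous w)
    (hwK : ∀ x, ‖w x‖ ≤ K * Real.exp (2 * ∫ y in Set.Ioi x, β y)) (i : ι) (a : ℝ) :
    IntegrableOn (fun y : ℝ => exp (-(m i * y)) * (V y *ᵥ w y) i) (Set.Ioi a) := by
  refine Integrable.mono' (((integrableOn_weight hβc hβ hβ0 a).const_mul K).const_mul
    ‖exp (-(m i * a))‖) (continuous_volterra_integrand hV hw i).aestronglyMeasurable ?_
  filter_upwards [ae_restrict_mem measurableSet_Ioi] with s hs
  rw [norm_mul]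
  exact mul_le_mul (norm_exp_neg_le hm (le_of_lt hs))
    (norm_mulVec_apply_le_weight hβ0 hVβ hwK s i) (norm_nonneg _) (norm_nonneg _)

include hm hV hβc hβ hβ0 hVβ in
theorem hasDerivAt_volterra (hw : Continuous w)
    (hwK : ∀ x, ‖w x‖ ≤ K * Real.exp (2 * ∫ y in Set.Ioi x, β y)) (i : ι) (x : ℝ) :
    HasDerivAt (fun x => volterra m V w x i) (m i * volterra m V w x i - (V x *ᵥ w x) i) x := by
  have h1 : HasDerivAt (fun x : ℝ => m i * (x : ℂ)) (m i * 1) x :=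
    (hasDerivAt_id x).ofReal_comp.const_mul (m i)
  have h2 := hasDerivAt_integral_Ioi (continuous_volterra_integrand (m := m) hV hw i)
    (integrableOn_volterra hm hV hβc hβ hβ0 hVβ hw hwK i) x
  refine (h1.cexp.mul h2).congr_deriv ?_
  have h3 : exp (m i * x) * exp (-(m i * x)) = 1 := by rw [← exp_add]; simp
  rw [volterra]
  linear_combination (-(V x *ᵥ w x) i) * h3

include hm hβc hβ hβ0 hVβ in
-- The kernel `e^{m(x - y)}` has modulus at most 1 for `y ≥ x`, so only `∫ βW` over `(x, ∞)`
-- remains.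
theorem norm_volterra_le
    (hwK : ∀ x, ‖w x‖ ≤ K * Real.exp (2 * ∫ y in Set.Ioi x, β y)) (i : ι) (x : ℝ) :
    ‖volterra m V w x i‖ ≤ K * ((Real.exp (2 * ∫ y in Set.Ioi x, β y) - 1) / 2) := by
  have h : ‖∫ y in Set.Ioi x, exp (-(m i * y)) * (V y *ᵥ w y) i‖
      ≤ ‖exp (-(m i * x))‖ * (K * ((Real.exp (2 * ∫ y in Set.Ioi x, β y) - 1) / 2)) := by
    rw [← integral_Ioi_weight hβc hβ hβ0 x, ← integral_const_mul, ← integral_const_mul]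
    refine norm_integral_le_of_norm_le
      (((integrableOn_weight hβc hβ hβ0 x).const_mul K).const_mul _) ?_
    filter_upwards [ae_restrict_mem measurableSet_Ioi] with s hs
    rw [norm_mul]
    exact mul_le_mul (norm_exp_neg_le hm (le_of_lt hs))
      (norm_mulVec_apply_le_weight hβ0 hVβ hwK s i) (norm_nonneg _) (norm_nonneg _)
  have h3 : ‖exp (m i * x)‖ * ‖exp (-(m i * x))‖ = 1 := by
    rw [← norm_mul, ← exp_add]; simp
  rw [volterra, norm_mul]
  refine (mul_le_mul_of_nonneg_left h (norm_nonneg _)).trans_eq ?_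
  rw [← mul_assoc, h3, one_mul]

include hm hV hβc hβ hβ0 hVβ in
theorem volterra_sub {w' : ℝ → ι → ℂ} {K' : ℝ} (hw : Continuous w) (hw' : Continuous w')
    (hwK : ∀ x, ‖w x‖ ≤ K * Real.exp (2 * ∫ y in Set.Ioi x, β y))
    (hwK' : ∀ x, ‖w' x‖ ≤ K' * Real.exp (2 * ∫ y in Set.Ioi x, β y)) (i : ι) (x : ℝ) :
    volterra m V w x i - volterra m V w' x i = volterra m V (fun y => w y - w' y) x i := by
  rw [volterra, volterra, volterra, ← mul_sub,
    ← integral_sub (integrableOn_volterra hm hV hβc hβ hβ0 hVβ hw hwK i x)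
      (integrableOn_volterra hm hV hβc hβ hβ0 hVβ hw' hwK' i x)]
  simp only [mulVec_sub, Pi.sub_apply, mul_sub]

include hm hV hβc hβ hβ0 hVβ in
/-- A linear system `w' = m w + V w` with diagonal `m`, `0 ≤ Re m`, and a coefficient `V` that is
integrable at `+∞` has a solution on the line which tends to a given vector of the kernel of `m`. -/
theorem exists_solution_tendsto (e : ι → ℂ) (he : ∀ i, m i * e i = 0) :
    ∃ w : ℝ → ι → ℂ, (∀ x, HasDerivAt w (fun i => m i * w x i + (V x *ᵥ w x) i) x) ∧
      Tendsto w atTop (𝓝 e) := by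
  -- Integrability of `β` is available only near `+∞`, so the solution may grow at `-∞`. The fixed
  -- point is therefore sought in the form `W • v` with `v` bounded, which gives a solution on the
  -- whole line at once.
  set W : ℝ → ℝ := fun x => Real.exp (2 * ∫ y in Set.Ioi x, β y) with hW
  have hWc : Continuous W := continuous_integral_Ioi_weight hβc hβ
  have hW0 : ∀ x, 0 < W x := fun x => Real.exp_pos _
  have hW1 : ∀ x, 1 ≤ W x := fun x =>
    Real.one_le_exp (mul_nonneg zero_le_two (integral_nonneg hβ0))
  set up : (ℝ →ᵇ (ι → ℂ)) → ℝ → ι → ℂ := fun v x => W x • v x with hup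
  have hupc : ∀ v, Continuous (up v) := fun v => hWc.smul v.continuous
  have hupK : ∀ v x, ‖up v x‖ ≤ ‖v‖ * W x := fun v x => by
    rw [hup, norm_smul, Real.norm_of_nonneg (hW0 x).le, mul_comm]
    exact mul_le_mul_of_nonneg_right (v.norm_coe_le_norm x) (hW0 x).le
  have hvc : ∀ v, Continuous (volterra m V (up v)) := fun v => continuous_pi fun i =>
    continuous_iff_continuousAt.2 fun x =>
      (hasDerivAt_volterra hm hV hβc hβ hβ0 hVβ (hupc v) (hupK v) i x).continuousAt
  have hvb : ∀ v x, ‖volterra m V (up v) x‖ ≤ ‖v‖ * W x := fun v x => by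
    refine (pi_norm_le_iff_of_nonneg (mul_nonneg (norm_nonneg _) (hW0 x).le)).2 fun i =>
      (norm_volterra_le hm hβc hβ hβ0 hVβ (hupK v) i x).trans ?_
    exact mul_le_mul_of_nonneg_left (by have := hW0 x; simp only [hW] at this ⊢; linarith)
      (norm_nonneg _)
  -- The integral equation `w = e - volterra w`, written for `v = W⁻¹ w`.
  set T : (ℝ →ᵇ (ι → ℂ)) → (ℝ →ᵇ (ι → ℂ)) := fun v =>
    BoundedContinuousFunction.ofNormedAddCommGroup
      (fun x => (W x)⁻¹ • (e - volterra m V (up v) x))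
      ((hWc.inv₀ fun x => (hW0 x).ne').smul (continuous_const.sub (hvc v)))
      (‖e‖ + ‖v‖) (fun x => by
        rw [norm_smul, norm_inv, Real.norm_of_nonneg (hW0 x).le, inv_mul_le_iff₀ (hW0 x)]
        refine (norm_sub_le _ _).trans ?_
        have := hvb v x
        nlinarith [norm_nonneg e, hW1 x]) with hT
  have hTc : ContractingWith (1 / 2) T := by
    refine ⟨by norm_num, LipschitzWith.of_dist_le_mul fun v v' => ?_⟩
    have hd : (0 : ℝ) ≤ ((1 / 2 : NNReal) : ℝ) * dist v v' := by positivity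
    refine (BoundedContinuousFunction.dist_le hd).2 fun x => ?_
    have h1 : T v x - T v' x = (W x)⁻¹ • (-volterra m V (up (v - v')) x) := by
      funext i
      have h2 := volterra_sub hm hV hβc hβ hβ0 hVβ (hupc v) (hupc v') (hupK v) (hupK v') i x
      have h3 : (fun y => up v y - up v' y) = up (v - v') := by
        funext y; simp [hup, smul_sub]
      rw [h3] at h2
      simp only [hT, BoundedContinuousFunction.coe_ofNormedAddCommGroup, Pi.sub_apply,
        Pi.smul_apply, Pi.neg_apply, ← h2, real_smul]
      ring
    rw [dist_eq_norm, h1, norm_smul, norm_inv, Real.norm_of_nonneg (hW0 x).le,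
      inv_mul_le_iff₀ (hW0 x), norm_neg]
    refine (pi_norm_le_iff_of_nonneg (mul_nonneg (hW0 x).le hd)).2 fun i =>
      (norm_volterra_le hm hβc hβ hβ0 hVβ (hupK (v - v')) i x).trans ?_
    rw [dist_eq_norm]
    push_cast
    have := norm_nonneg (v - v')
    simp only [hW]
    nlinarith
  set v := ContractingWith.fixedPoint T hTc
  have hv : T v = v := hTc.fixedPoint_isFixedPt
  have hw : ∀ x i, up v x i = e i - volterra m V (up v) x i := fun x i => by
    have h1 : v x = (W x)⁻¹ • (e - volterra m V (up v) x) := by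
      conv_lhs => rw [← hv]
      rfl
    have h2 : up v x = e - volterra m V (up v) x := by
      conv_lhs => rw [hup]
      simp only
      rw [h1, smul_smul, mul_inv_cancel₀ (hW0 x).ne', one_smul]
    rw [h2]; rfl
  refine ⟨up v, fun x => hasDerivAt_pi.2 fun i => ?_, ?_⟩
  · have h := (hasDerivAt_volterra hm hV hβc hβ hβ0 hVβ (hupc v) (hupK v) i x).const_sub (e i)
    have h2 : (fun x => up v x i) = fun x => e i - volterra m V (up v) x i := funext fun x => hw x i
    rw [h2]
    refine h.congr_deriv ?_
    -- The constant `e` contributes no term `m e` to the equation, since it lies in the kernel of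
    -- `m`.
    linear_combination -m i * hw x i - he i
  · refine tendsto_pi_nhds.2 fun i => ?_
    have h2 : (fun x => up v x i) = fun x => e i - volterra m V (up v) x i := funext fun x => hw x i
    rw [h2]
    have h3 : Tendsto (fun x => volterra m V (up v) x i) atTop (𝓝 0) := by
      refine squeeze_zero_norm (norm_volterra_le hm hβc hβ hβ0 hVβ (hupK v) i) ?_
      simpa using (((tendsto_integral_Ioi_weight hβ).sub_const 1).div_const 2).const_mul ‖v‖
    simpa using h3.const_sub (e i)

end Existence

/-! ### Algebra of the uniformizing variable `z`. -/

section Spectral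

variable {α u₀ : ℝ} {z : ℂ}

/-- Multiplied with the identity that follows, this gives `λ² - α²k² = u₀²`; hence `X` at a boundary
value of the potential has eigenvalues `±ikλ`. -/
theorem mul_specK_add_specLam (hα : α ≠ 0) : (α : ℂ) * specK α u₀ z + specLam u₀ z = z := by
  have : (α : ℂ) ≠ 0 := ofReal_ne_zero.2 hα
  by_cases hz : z = 0
  · simp [specK, specLam, hz]
  unfold specK specLam
  field_simp
  ring

theorem specLam_sub_mul_specK (hα : α ≠ 0) :
    specLam u₀ z - (α : ℂ) * specK α u₀ z = (u₀ : ℂ) ^ 2 / z := by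
  have : (α : ℂ) ≠ 0 := ofReal_ne_zero.2 hα
  unfold specK specLam
  field_simp
  ring

theorem specK_mul_specLam :
    specK α u₀ z * specLam u₀ z = (z ^ 2 - (u₀ : ℂ) ^ 4 / z ^ 2) / (4 * α : ℝ) := by
  by_cases hα : (α : ℂ) = 0
  · simp [specK, hα]
  by_cases hz : z = 0
  · simp [specK, specLam, hz]
  unfold specK specLam
  push_cast
  field_simp
  ring

/-- For `α > 0` the sign of `Im(kλ)` is that of `Re z · Im z`: both `z²` and `-1/z²` have imaginary
parts of this sign. This is how `D⁺`, `D⁻` and `Σ` enter the estimates. -/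
theorem im_specK_mul_specLam (hz : z ≠ 0) :
    (specK α u₀ z * specLam u₀ z).im
      = z.re * z.im * (2 * (1 + u₀ ^ 4 / normSq z ^ 2) / (4 * α)) := by
  have h1 : (u₀ : ℂ) ^ 4 / z ^ 2 = ((u₀ ^ 4 / normSq z ^ 2 : ℝ) : ℂ) * (starRingEnd ℂ z) ^ 2 := by
    have h2 : (normSq z : ℂ) = z * starRingEnd ℂ z := (mul_conj z).symm
    have h3 : starRingEnd ℂ z ≠ 0 := by simpa using hz
    push_cast
    rw [h2]
    field_simp
  rw [specK_mul_specLam, h1, div_ofReal_im, sub_im, im_ofReal_mul]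
  simp only [pow_two, mul_im, conj_re, conj_im]
  ring

theorem hasDerivAt_exp_phase (t x : ℝ) (c : ℂ) :
    HasDerivAt (fun x : ℝ => exp (c * phase α u₀ x t z))
      (-(c * (specK α u₀ z * specLam u₀ z)) * exp (c * phase α u₀ x t z)) x := by
  have h : HasDerivAt (fun x : ℝ => c * phase α u₀ x t z)
      (c * -(specK α u₀ z * specLam u₀ z * 1)) x := by
    unfold phase
    exact (((hasDerivAt_id x).ofReal_comp.add_const _).const_mul _).neg.const_mul c
  refine h.cexp.congr_deriv ?_
  ring

end Spectral

/-! ### Existence of the first Jost column at `+∞`. -/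

theorem hasDerivAt_const_mulVec {ι : Type*} [Fintype ι] [DecidableEq ι] (P : Matrix ι ι ℂ)
    {w : ℝ → ι → ℂ} {w' : ι → ℂ} {x : ℝ} (hw : HasDerivAt w w' x) :
    HasDerivAt (fun x => P *ᵥ w x) (P *ᵥ w') x := by
  have := ((LinearMap.toContinuousLinearMap (Matrix.mulVecLin P)).restrictScalars ℝ).hasFDerivAt
    (x := w x)
  exact this.comp_hasDerivAt x hw

open scoped Matrix.Norms.Operator in
theorem exists_norm_potQ_mulVec_le (P R : Matrix (Fin 2) (Fin 2) ℂ) (c : ℂ) :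
    ∃ C : ℝ, 0 ≤ C ∧ ∀ d w, ‖(R * (c • potQ d) * P) *ᵥ w‖ ≤ C * ‖d‖ * ‖w‖ := by
  refine ⟨‖R‖ * ‖c‖ * ‖P‖, by positivity, fun d w => ?_⟩
  have hd : ‖potQ d‖ ≤ ‖d‖ := by
    rw [linfty_opNorm_def, ← coe_nnnorm d, NNReal.coe_le_coe]
    refine Finset.sup_le fun i _ => ?_
    fin_cases i <;> simp [potQ]
  calc _ ≤ ‖R * (c • potQ d) * P‖ * ‖w‖ := linfty_opNorm_mulVec _ _
    _ ≤ (‖R‖ * (‖c‖ * ‖d‖) * ‖P‖) * ‖w‖ := by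
      refine mul_le_mul_of_nonneg_right ?_ (norm_nonneg _)
      refine (norm_mul_le _ _).trans (mul_le_mul_of_nonneg_right ?_ (norm_nonneg _))
      refine (norm_mul_le _ _).trans (mul_le_mul_of_nonneg_left ?_ (norm_nonneg _))
      exact (norm_smul_le _ _).trans (mul_le_mul_of_nonneg_left hd (norm_nonneg _))
    _ = _ := by ring

variable {α u₀ t : ℝ} {z : ℂ} {u : ℝ → ℝ → ℂ} {v : ℂ}

theorem exists_isJostColumn_atTop_zero (hα : α ≠ 0) (hv : ‖v‖ = u₀)
    (hu : Continuous fun x => u x t) (hint : IntegrableOn (fun x => u x t - v) (Set.Ici 0))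
    (hz : z ≠ 0) (hlam : specLam u₀ z ≠ 0) (him : (specK α u₀ z * specLam u₀ z).im ≤ 0) :
    ∃ φ, IsJostColumn atTop v α u₀ u 0 t z φ := by
  set k := specK α u₀ z with hk
  set lam := specLam u₀ z with hl
  have hsum : (α : ℂ) * k + lam = z := mul_specK_add_specLam hα
  have hdiff : lam - (α : ℂ) * k = (u₀ : ℂ) ^ 2 / z := specLam_sub_mul_specK hα
  have hvv : v * starRingEnd ℂ v = (u₀ : ℂ) ^ 2 := by rw [mul_conj', hv]
  set s := starRingEnd ℂ v / z with hs
  set B := v / (2 * lam) with hB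
  -- `P` is a lower unipotent matrix times an upper unipotent one, so its determinant is 1. Its
  -- columns are eigenvectors of `X` at the boundary value `v`, and the first is the first column of
  -- `Y`.
  set P : Matrix (Fin 2) (Fin 2) ℂ := !![1, B; -s, 1 - s * B] with hP
  set R : Matrix (Fin 2) (Fin 2) ℂ := !![1 - s * B, -B; s, 1] with hR
  have hPR : P * R = 1 := by
    ext i j; fin_cases i <;> fin_cases j <;> simp [hP, hR, Matrix.mul_apply] <;> ring
  have hXP : ∀ w : Fin 2 → ℂ, laxX α u₀ z v *ᵥ (P *ᵥ w)
      = P *ᵥ ![-(I * (k * lam)) * w 0, I * (k * lam) * w 1] := by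
    intro w
    have h1 : (u₀ : ℂ) ^ 2 = z * (lam - α * k) := by rw [hdiff]; field_simp
    have hsv : s * v = lam - α * k := by
      rw [hs, div_mul_eq_mul_div, mul_comm _ v, hvv, hdiff]
    have hBl : B * lam * 2 = v := by rw [hB]; field_simp
    have hsz : starRingEnd ℂ v = s * (α * k + lam) := by rw [hsum, hs]; field_simp
    funext i
    fin_cases i
    · simp [laxX, potQ, sigma3, hP, ← hk, Matrix.mulVec, dotProduct, Fin.sum_univ_two]
      linear_combination (-(I * k * w 0) - I * k * B * w 1) * hsv - I * k * w 1 * hBl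
    · simp [laxX, potQ, sigma3, hP, ← hk, Matrix.mulVec, dotProduct, Fin.sum_univ_two]
      rw [hsz]
      linear_combination I * k * s * w 1 * hBl + I * k * w 1 * hsv
  obtain ⟨C, hC0, hC⟩ := exists_norm_potQ_mulVec_le P R (I * k)
  have hpot : Continuous potQ := by
    refine continuous_matrix fun i j => ?_
    fin_cases i <;> fin_cases j <;> simp [potQ] <;> fun_prop
  -- Splitting off `e^{iθ}`, whose logarithmic derivative is `-ikλ`, shifts the eigenvalues `∓ikλ`
  -- to `0` and `2ikλ`. Then `Re(2ikλ) = -2 Im(kλ) ≥ 0`, and the vector `(1, 0)` lies in the kernel.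
  obtain ⟨w, hw, hw1⟩ := exists_solution_tendsto (m := ![0, 2 * I * (k * lam)])
    (V := fun x => R * ((I * k) • potQ (u x t - v)) * P) (β := fun x => C * ‖u x t - v‖)
    (by
      intro i
      fin_cases i
      · simp
      · have : (2 * I * (k * lam)).re = -2 * (k * lam).im := by simp [mul_assoc]; ring
        simp only [Fin.mk_one, cons_val_one, cons_val_fin_one, this]
        linarith)
    ((continuous_const.matrix_mul
      ((hpot.comp (hu.sub continuous_const)).const_smul (I * k))).matrix_mul continuous_const)
    (by fun_prop)
    (fun a => by
      have h1 : IntegrableOn (fun x => u x t - v) (Set.Ioi a) := by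
        have h2 : IntegrableOn (fun x => u x t - v) (Set.Icc a 0) :=
          (hu.sub continuous_const).continuousOn.integrableOn_Icc
        refine (h2.union hint).mono_set fun x hx => ?_
        rcases le_total x 0 with h | h
        · exact Or.inl ⟨le_of_lt hx, h⟩
        · exact Or.inr h
      exact h1.norm.const_mul C)
    (fun x => by positivity) (fun x => hC _) ![1, 0] (by intro i; fin_cases i <;> simp)
  have hE : ∀ x, exp (-(I * phase α u₀ x t z)) * exp (I * phase α u₀ x t z) = 1 := fun x => by
    rw [← exp_add]; simp
  refine ⟨fun x => exp (I * phase α u₀ x t z) • (P *ᵥ w x), fun x => ?_, ?_⟩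
  · refine ((hasDerivAt_exp_phase t x I).smul (hasDerivAt_const_mulVec P (hw x))).congr_deriv ?_
    have h1 : laxX α u₀ z (u x t) = laxX α u₀ z v + (I * k) • potQ (u x t - v) := by
      ext i j
      fin_cases i <;> fin_cases j <;> simp [laxX, potQ, sigma3, ← hk] <;> ring
    have h2 : P *ᵥ ((R * ((I * k) • potQ (u x t - v)) * P) *ᵥ w x)
        = ((I * k) • potQ (u x t - v)) *ᵥ (P *ᵥ w x) := by
      rw [mulVec_mulVec, mulVec_mulVec, ← Matrix.mul_assoc, ← Matrix.mul_assoc, hPR, Matrix.one_mul]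
    rw [mulVec_smul, h1, add_mulVec, hXP, ← h2, ← mulVec_add]
    set y := (R * ((I * k) • potQ (u x t - v)) * P) *ᵥ w x
    have h3 : (-(I * (k * lam)) * exp (I * phase α u₀ x t z)) • (P *ᵥ w x)
        = exp (I * phase α u₀ x t z) • (P *ᵥ ((-(I * (k * lam))) • w x)) := by
      rw [mulVec_smul, smul_smul, mul_comm]
    rw [h3, ← smul_add, ← mulVec_add]
    congr 2
    funext i
    fin_cases i
    · simp; ring
    · simp; ring
  · have h1 : (fun x => expSigma3 (-(I * phase α u₀ x t z)) 0 0 •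
        (exp (I * phase α u₀ x t z) • (P *ᵥ w x))) = fun x => P *ᵥ w x := by
      funext x
      rw [smul_smul]
      simp [expSigma3, hE x]
    rw [h1]
    have h2 : (fun i => eigY z v i 0) = P *ᵥ ![1, 0] := by
      funext i
      fin_cases i <;> simp [eigY, sigma3, potQ, hP, hs, Matrix.mulVec, dotProduct]; ring
    rw [h2]
    exact ((continuous_const.matrix_mulVec continuous_id).tendsto _).comp hw1

/-- `(1 / 2α) ∫ₓ^∞ (u₀² - |u|²) dy`. -/
noncomputable def tailPhase (α u₀ : ℝ) (u : ℝ → ℝ → ℂ) (t x : ℝ) : ℝ :=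
  1 / (2 * α) * ∫ y in Set.Ioi x, (u₀ ^ 2 - ‖u y t‖ ^ 2)

/-! ### Large-`z` asymptotics of the first Jost column at `+∞`. -/

section Estimate

variable {α u₀ t : ℝ} {z : ℂ} {u : ℝ → ℝ → ℂ} {v : ℂ}

/-- In this range `z` dominates `u₀²/z`, which makes `λ` bounded below and `k` bounded above by
multiples of `|z|`. -/
theorem norm_sq_div_le (hu₀ : 0 ≤ u₀) (h : 2 * u₀ ≤ ‖z‖) : ‖(u₀ : ℂ) ^ 2 / z‖ ≤ ‖z‖ / 4 := by
  rcases eq_or_ne z 0 with rfl | hz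
  · simp
  have hz' : 0 < ‖z‖ := norm_pos_iff.2 hz
  rw [norm_div, norm_pow, norm_real, Real.norm_of_nonneg hu₀, div_le_iff₀ hz']
  nlinarith

theorem le_norm_specLam (hu₀ : 0 ≤ u₀) (h : 2 * u₀ ≤ ‖z‖) : ‖z‖ / 4 ≤ ‖specLam u₀ z‖ := by
  have h1 := norm_sq_div_le hu₀ h
  have h2 : ‖z‖ - ‖(u₀ : ℂ) ^ 2 / z‖ ≤ ‖z + (u₀ : ℂ) ^ 2 / z‖ := by
    have := norm_sub_norm_le z (-((u₀ : ℂ) ^ 2 / z))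
    rwa [sub_neg_eq_add, norm_neg] at this
  rw [specLam, norm_div, norm_ofNat]
  linarith [norm_nonneg z]

theorem norm_specK_le (hα : 0 < α) (hu₀ : 0 ≤ u₀) (h : 2 * u₀ ≤ ‖z‖) :
    ‖specK α u₀ z‖ ≤ ‖z‖ / α := by
  have h1 := norm_sq_div_le hu₀ h
  have h2 := norm_sub_le z ((u₀ : ℂ) ^ 2 / z)
  rw [specK, norm_div, norm_mul, norm_ofNat, norm_real, Real.norm_of_nonneg hα.le,
    div_le_div_iff₀ (by positivity) hα]
  nlinarith [norm_nonneg z]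

theorem specK_div_sub (hα : α ≠ 0) (hz : z ≠ 0) :
    specK α u₀ z / z - 1 / (2 * α) = -((u₀ : ℂ) ^ 2 / (2 * α) / z / z) := by
  have : (α : ℂ) ≠ 0 := ofReal_ne_zero.2 hα
  unfold specK
  field_simp
  ring

/-- A triangular change of unknowns that diagonalizes the spatial part of the Lax pair up to
integrable terms of order `z⁻¹`. -/
theorem hasDerivAt_diagonalized (hα : α ≠ 0) (hz : z ≠ 0) (hlam : specLam u₀ z ≠ 0)
    {w : ℝ → ℂ} {w' : ℂ} {φ : ℝ → Fin 2 → ℂ} {x : ℝ} (hw : HasDerivAt w w' x)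
    (hφ : HasDerivAt φ (laxX α u₀ z (w x) *ᵥ φ x) x) {q s B : ℝ → ℂ} {s' B' r : ℂ}
    (hq : q x = u₀ ^ 2 - w x * starRingEnd ℂ (w x))
    (hs : s = fun x => starRingEnd ℂ (w x) / z) (hs' : s' = starRingEnd ℂ w' / z)
    (hB : B = fun x => w x / (2 * specLam u₀ z)) (hB' : B' = w' / (2 * specLam u₀ z))
    (hr : r = I * specK α u₀ z / z * q x * s x + s')
    {ψ χ : ℝ → ℂ} (hψ : ψ = fun x => φ x 1 + s x * φ x 0)
    (hχ : χ = fun x => φ x 0 - B x * ψ x) :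
    HasDerivAt χ ((-(I * (specK α u₀ z * specLam u₀ z)) + I * specK α u₀ z / z * q x
        - B x * r) * χ x + (2 * I * specK α u₀ z / z * q x * B x - B' - B x ^ 2 * r) * ψ x) x ∧
    HasDerivAt ψ ((I * (specK α u₀ z * specLam u₀ z) - I * specK α u₀ z / z * q x
        + B x * r) * ψ x + r * χ x) x := by
  set k := specK α u₀ z with hk
  set lam := specLam u₀ z with hl
  have hsum : (α : ℂ) * k + lam = z := mul_specK_add_specLam hα
  have hdiff : lam - (α : ℂ) * k = (u₀ : ℂ) ^ 2 / z := specLam_sub_mul_specK hα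
  have hsd : HasDerivAt s s' x := by
    rw [hs, hs']
    exact (hw.star).div_const z
  have hBd : HasDerivAt B B' x := by
    rw [hB, hB']
    exact hw.div_const _
  have h0 := hasDerivAt_pi.1 hφ 0
  have h1 := hasDerivAt_pi.1 hφ 1
  have e0 : (laxX α u₀ z (w x) *ᵥ φ x) 0 = -(I * α * k ^ 2) * φ x 0 + I * k * w x * φ x 1 := by
    simp [laxX, potQ, sigma3, ← hk, Matrix.mulVec, dotProduct, Fin.sum_univ_two]
  have e1 : (laxX α u₀ z (w x) *ᵥ φ x) 1
      = I * k * starRingEnd ℂ (w x) * φ x 0 + I * α * k ^ 2 * φ x 1 := by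
    simp [laxX, potQ, sigma3, ← hk, Matrix.mulVec, dotProduct, Fin.sum_univ_two]
  rw [e0] at h0
  rw [e1] at h1
  -- At a boundary value `w s` would be exactly `u₀²/z`, and the lower-left entry would vanish up to
  -- `s'`. The defect is `q/z`, with `q = u₀² - |w|²`.
  have hus : w x * s x = lam - α * k - q x / z := by
    rw [hdiff, hq, hs]; ring
  have hub : starRingEnd ℂ (w x) = s x * (α * k + lam) := by
    rw [hsum, hs]; field_simp
  have hBl : w x = 2 * B x * lam := by rw [hB]; field_simp
  have hψx : ψ x = φ x 1 + s x * φ x 0 := by rw [hψ]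
  have hχx : χ x = φ x 0 - B x * ψ x := by rw [hχ]
  have hψd : HasDerivAt ψ ((I * (k * lam) - I * k / z * q x
        + B x * r) * ψ x + r * χ x) x := by
    rw [hψ]
    refine (h1.add (hsd.mul h0)).congr_deriv ?_
    rw [hχx, hψx, hr]
    linear_combination I * k * φ x 0 * hub + I * k * φ x 1 * hus
  refine ⟨?_, hψd⟩
  rw [hχ]
  refine (h0.sub (hBd.mul hψd)).congr_deriv ?_
  simp only
  rw [hχx]
  linear_combination (-I) * k * φ x 0 * hus + I * k * ψ x * hBl - I * k * w x * hψx

theorem continuous_sq_sub_norm_sq (hu : Continuous fun x => u x t) :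
    Continuous fun y => u₀ ^ 2 - ‖u y t‖ ^ 2 := by
  fun_prop

theorem hasDerivAt_tailPhase (hu : Continuous fun x => u x t)
    (hq : Integrable fun y => u₀ ^ 2 - ‖u y t‖ ^ 2) (x : ℝ) :
    HasDerivAt (tailPhase α u₀ u t) (-(1 / (2 * α) * (u₀ ^ 2 - ‖u x t‖ ^ 2))) x := by
  refine ((hasDerivAt_integral_Ioi (continuous_sq_sub_norm_sq hu)
    (fun a => hq.integrableOn) x).const_mul (1 / (2 * α))).congr_deriv ?_
  ring

theorem tendsto_tailPhase (hq : Integrable fun y => u₀ ^ 2 - ‖u y t‖ ^ 2) :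
    Tendsto (tailPhase α u₀ u t) atTop (𝓝 0) := by
  have := (tendsto_integral_Ioi_atTop fun a => hq.integrableOn (s := Set.Ioi a)).const_mul
    (1 / (2 * α))
  rwa [mul_zero] at this

/-- The coefficients of the diagonalized system are of order `z⁻¹`. -/
theorem norm_coeff_le (hα : 0 < α) (hu₀ : 0 ≤ u₀) (hz1 : 1 ≤ ‖z‖) (hz2 : 2 * u₀ ≤ ‖z‖)
    {K : ℝ} {w w' q s B B' r : ℂ} (hwK : ‖w‖ ≤ K)
    (hs : s = starRingEnd ℂ w / z) (hB : B = w / (2 * specLam u₀ z))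
    (hB' : B' = w' / (2 * specLam u₀ z))
    (hr : r = I * specK α u₀ z / z * q * s + starRingEnd ℂ w' / z) :
    ‖B‖ ≤ 2 * K / ‖z‖ ∧ ‖r‖ ≤ (K / α * ‖q‖ + ‖w'‖) / ‖z‖ ∧
    ‖I * (specK α u₀ z / z - 1 / (2 * α)) * q - B * r‖
      ≤ (u₀ ^ 2 / (2 * α) * ‖q‖ + 2 * K * (K / α * ‖q‖ + ‖w'‖)) / ‖z‖ ∧
    ‖2 * I * specK α u₀ z / z * q * B - B' - B ^ 2 * r‖
      ≤ (4 * K / α * ‖q‖ + 2 * ‖w'‖ + 4 * K ^ 2 * (K / α * ‖q‖ + ‖w'‖)) / ‖z‖ := by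
  have hz0 : 0 < ‖z‖ := by linarith
  have hz : z ≠ 0 := norm_pos_iff.1 hz0
  have hK : 0 ≤ K := (norm_nonneg _).trans hwK
  have hl := le_norm_specLam hu₀ hz2
  have hl0 : 0 < ‖specLam u₀ z‖ := by linarith
  have hinv : ‖z‖⁻¹ ≤ 1 := inv_le_one_of_one_le₀ hz1
  have hdivl : ∀ y : ℂ, ‖y / (2 * specLam u₀ z)‖ ≤ 2 * ‖y‖ / ‖z‖ := fun y => by
    rw [norm_div, norm_mul, norm_ofNat, div_le_div_iff₀ (by positivity) hz0]
    nlinarith [norm_nonneg y]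
  have hkz : ‖specK α u₀ z / z‖ ≤ 1 / α := by
    rw [norm_div, div_le_iff₀ hz0]
    exact (norm_specK_le hα hu₀ hz2).trans_eq (by ring)
  have hs1 : ‖s‖ ≤ K / ‖z‖ := by
    rw [hs, norm_div, RCLike.norm_conj]
    exact div_le_div_of_nonneg_right hwK hz0.le
  have hB1 : ‖B‖ ≤ 2 * K / ‖z‖ := by
    rw [hB]
    exact (hdivl w).trans (by gcongr)
  have hB2 : ‖B‖ ≤ 2 * K := hB1.trans (div_le_self (by positivity) hz1)
  have hB'1 : ‖B'‖ ≤ 2 * ‖w'‖ / ‖z‖ := by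
    rw [hB']
    exact hdivl w'
  have hr1 : ‖r‖ ≤ (K / α * ‖q‖ + ‖w'‖) / ‖z‖ := by
    rw [hr]
    refine (norm_add_le _ _).trans ?_
    rw [add_div, norm_div (starRingEnd ℂ w'), RCLike.norm_conj, mul_div_assoc I, norm_mul,
      norm_mul, norm_mul, norm_I, one_mul]
    refine add_le_add ?_ le_rfl
    calc _ ≤ 1 / α * ‖q‖ * (K / ‖z‖) := by gcongr
      _ = _ := by ring
  refine ⟨hB1, hr1, ?_, ?_⟩
  · refine (norm_sub_le _ _).trans ?_
    rw [add_div]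
    refine add_le_add ?_ ?_
    · rw [specK_div_sub hα.ne' hz, norm_mul, norm_mul, norm_I, one_mul, norm_neg, norm_div,
        norm_div, norm_div, norm_pow, norm_mul, norm_ofNat, norm_real, norm_real,
        Real.norm_of_nonneg hu₀, Real.norm_of_nonneg hα.le]
      have : u₀ ^ 2 / (2 * α) / ‖z‖ / ‖z‖ ≤ u₀ ^ 2 / (2 * α) / ‖z‖ :=
        div_le_self (by positivity) hz1
      calc _ ≤ u₀ ^ 2 / (2 * α) / ‖z‖ * ‖q‖ := by gcongr
        _ = _ := by ring
    · rw [norm_mul, mul_div_assoc]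
      gcongr
  · refine (norm_sub_le _ _).trans ?_
    rw [add_div]
    refine add_le_add ((norm_sub_le _ _).trans ?_) ?_
    · rw [add_div]
      refine add_le_add ?_ hB'1
      rw [mul_div_assoc, norm_mul, norm_mul, norm_mul, norm_mul, norm_ofNat, norm_I, mul_one]
      calc _ ≤ 2 * (1 / α) * ‖q‖ * (2 * K / ‖z‖) := by gcongr
        _ = _ := by ring
    · rw [norm_mul, norm_pow, mul_div_assoc]
      have : ‖B‖ ^ 2 ≤ 4 * K ^ 2 := by nlinarith [norm_nonneg B]
      gcongr

theorem norm_mul_add_mul_le {c d : ℂ} {C D : ℝ} (hc : ‖c‖ ≤ C) (hd : ‖d‖ ≤ D) (x y : ℂ) :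
    ‖c * x + d * y‖ ≤ (C + D) * max ‖x‖ ‖y‖ := by
  refine (norm_add_le _ _).trans ?_
  rw [norm_mul, norm_mul, add_mul]
  have hC := (norm_nonneg _).trans hc
  have hD := (norm_nonneg _).trans hd
  exact add_le_add (mul_le_mul hc (le_max_left _ _) (norm_nonneg _) hC)
    (mul_le_mul hd (le_max_right _ _) (norm_nonneg _) hD)

theorem norm_exp_neg_I_mul_ofReal (x : ℝ) : ‖exp (-(I * x))‖ = 1 := by
  simpa using norm_exp_I_mul_ofReal (-x)

/-- The first column of a Jost solution normalised at `+∞`, for large `z`. -/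
theorem exists_norm_isJostColumn_atTop_zero_le (hα : 0 < α) (hu₀ : 0 < u₀)
    (hu : ContDiff ℝ 1 fun x => u x t) {K : ℝ} (huK : ∀ x, ‖u x t‖ ≤ K)
    (hlim : Tendsto (fun x => u x t) atTop (𝓝 v))
    (hq : Integrable fun y => u₀ ^ 2 - ‖u y t‖ ^ 2) (hu' : Integrable (deriv fun x => u x t)) :
    ∃ C, ∀ z, C ≤ ‖z‖ → (specK α u₀ z * specLam u₀ z).im ≤ 0 → ∀ φ,
      IsJostColumn atTop v α u₀ u 0 t z φ → ∀ x,
      ‖exp (-(I * phase α u₀ x t z)) * φ x 0 - exp (-(I * tailPhase α u₀ u t x))‖ ≤ C / ‖z‖ ∧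
      ‖exp (-(I * phase α u₀ x t z)) * φ x 1‖ ≤ C / ‖z‖ := by
  have hK : 0 ≤ K := (norm_nonneg _).trans (huK 0)
  -- The sum of the three coefficient bounds of `norm_coeff_le`, without the factor `1/|z|`. It
  -- dominates both rows of the system and does not depend on `z`.
  set β : ℝ → ℝ := fun x =>
    (u₀ ^ 2 / (2 * α) * |u₀ ^ 2 - ‖u x t‖ ^ 2|
      + 2 * K * (K / α * |u₀ ^ 2 - ‖u x t‖ ^ 2| + ‖deriv (fun x => u x t) x‖))
    + (4 * K / α * |u₀ ^ 2 - ‖u x t‖ ^ 2| + 2 * ‖deriv (fun x => u x t) x‖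
      + 4 * K ^ 2 * (K / α * |u₀ ^ 2 - ‖u x t‖ ^ 2| + ‖deriv (fun x => u x t) x‖))
    + (K / α * |u₀ ^ 2 - ‖u x t‖ ^ 2| + ‖deriv (fun x => u x t) x‖) with hβ
  have hβ0 : ∀ x, 0 ≤ β x := fun x => by positivity
  have hβi : Integrable β := by
    have h1 := hq.abs
    have h2 := hu'.norm
    have h3 := (h1.const_mul (K / α)).add h2
    exact (((h1.const_mul (u₀ ^ 2 / (2 * α))).add (h3.const_mul (2 * K))).add
      (((h1.const_mul (4 * K / α)).add (h2.const_mul 2)).add (h3.const_mul (4 * K ^ 2)))).add h3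
  set J := ∫ x, β x with hJ
  have hJ0 : 0 ≤ J := integral_nonneg hβ0
  -- The first two terms force `|z| ≥ 1` and `|z| ≥ 2u₀`, the third makes `∫ β/|z| ≤ 1/2`, and the
  -- last two are the constants of the final bounds `m1` and `m2`.
  refine ⟨1 + 2 * u₀ + 2 * J + 2 * J * (1 + 2 * K) + (2 * J + K * (1 + 2 * J * (1 + 2 * K))),
    fun z hCz him φ hφ => ?_⟩
  have hJK : 0 ≤ 2 * J * (1 + 2 * K) := by positivity
  have hJK' : 0 ≤ 2 * J + K * (1 + 2 * J * (1 + 2 * K)) := by positivity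
  have hz1 : 1 ≤ ‖z‖ := by linarith
  have hz2 : 2 * u₀ ≤ ‖z‖ := by linarith
  have hz0 : 0 < ‖z‖ := by linarith
  have hz : z ≠ 0 := norm_pos_iff.1 hz0
  have hlam : specLam u₀ z ≠ 0 := by
    have := le_norm_specLam hu₀.le hz2
    exact norm_pos_iff.1 (by linarith)
  set k := specK α u₀ z with hk
  set lam := specLam u₀ z with hl
  set q : ℝ → ℂ := fun x => ((u₀ ^ 2 - ‖u x t‖ ^ 2 : ℝ) : ℂ) with hqdef
  have hqn : ∀ x, ‖q x‖ = |u₀ ^ 2 - ‖u x t‖ ^ 2| := fun x => norm_real _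
  set u' := deriv fun x => u x t with hu'def
  have hud : ∀ x, HasDerivAt (fun x => u x t) (u' x) x := fun x =>
    (hu.differentiable one_ne_zero x).hasDerivAt
  set s : ℝ → ℂ := fun x => starRingEnd ℂ (u x t) / z with hs
  set B : ℝ → ℂ := fun x => u x t / (2 * lam) with hB
  set r : ℝ → ℂ := fun x => I * k / z * q x * s x + starRingEnd ℂ (u' x) / z with hr
  set ψ : ℝ → ℂ := fun x => φ x 1 + s x * φ x 0 with hψ
  set χ : ℝ → ℂ := fun x => φ x 0 - B x * ψ x with hχ
  have hd := fun x => hasDerivAt_diagonalized (φ := φ) hα.ne' hz hlam (hud x) (hφ.1 x) (q := q)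
    (s := s) (s' := starRingEnd ℂ (u' x) / z) (B := B) (B' := u' x / (2 * lam)) (r := r x)
    (by simp only [hqdef]; rw [mul_conj']; push_cast; rfl) rfl rfl rfl rfl rfl hψ hχ
  have hcoef := fun x => norm_coeff_le (z := z) (w := u x t) (w' := u' x) (q := q x) (s := s x)
    (B := B x) (B' := u' x / (2 * lam)) (r := r x) hα hu₀.le hz1 hz2 (huK x) rfl rfl rfl rfl
  set E : ℝ → ℂ := fun x => exp (-(I * phase α u₀ x t z)) with hE
  have hEd : ∀ x, HasDerivAt E (I * (k * lam) * E x) x := fun x => by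
    have := hasDerivAt_exp_phase (α := α) (u₀ := u₀) (z := z) t x (-I)
    simpa only [neg_mul, neg_neg] using this
  set N : ℝ → ℝ := tailPhase α u₀ u t with hN
  have hNd : ∀ c x, HasDerivAt (fun x : ℝ => exp (c * (N x : ℂ)))
      (-(c * (1 / (2 * α) * q x)) * exp (c * (N x : ℂ))) x := fun c x => by
    have h := (hasDerivAt_tailPhase (α := α) hu.continuous hq x).ofReal_comp.const_mul c
    refine h.cexp.congr_deriv ?_
    simp only [hqdef, hN]
    push_cast
    ring
  have hNl : ∀ c : ℂ, Tendsto (fun x : ℝ => exp (c * (N x : ℂ))) atTop (𝓝 1) := fun c => by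
    have h1 := (continuous_ofReal.tendsto 0).comp (tendsto_tailPhase (α := α) hq)
    simpa using (h1.const_mul c).cexp
  have hNn : ∀ x, ‖exp (I * (N x : ℂ))‖ = 1 := fun x => norm_exp_I_mul_ofReal _
  have hNn' : ∀ x, ‖exp (-I * (N x : ℂ))‖ = 1 := fun x => by
    rw [neg_mul]; exact norm_exp_neg_I_mul_ofReal _
  have hNN : ∀ x, exp (-I * (N x : ℂ)) * exp (I * (N x : ℂ)) = 1 := fun x => by
    rw [← exp_add]; simp
  -- The factors `e^{±iN}` remove the diagonal terms `±i q/(2α)`, the only ones that do not decay as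
  -- `z → ∞`. The coefficient left on the diagonal is `±p`.
  set a : ℝ → ℂ := fun x => exp (I * (N x : ℂ)) * (E x * χ x) with ha
  set b : ℝ → ℂ := fun x => exp (-I * (N x : ℂ)) * (E x * ψ x) with hb
  have han : ∀ x, ‖a x‖ = ‖E x * χ x‖ := fun x => by rw [ha, norm_mul, hNn, one_mul]
  have hbn : ∀ x, ‖b x‖ = ‖E x * ψ x‖ := fun x => by rw [hb, norm_mul, hNn', one_mul]
  set p : ℝ → ℂ := fun x => I * (k / z - 1 / (2 * α)) * q x - B x * r x with hp
  have had : ∀ x, HasDerivAt a (exp (I * (N x : ℂ)) * (p x * (E x * χ x)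
      + (2 * I * k / z * q x * B x - u' x / (2 * lam) - B x ^ 2 * r x) * (E x * ψ x))) x := by
    intro x
    refine ((hNd I x).mul ((hEd x).mul (hd x).1)).congr_deriv ?_
    simp only [hp, Pi.mul_apply, ← hk, ← hl]
    ring
  have hbd : ∀ x, HasDerivAt b (2 * I * (k * lam) * b x + exp (-I * (N x : ℂ)) *
      (-p x * (E x * ψ x) + r x * (E x * χ x))) x := by
    intro x
    refine ((hNd (-I) x).mul ((hEd x).mul (hd x).2)).congr_deriv ?_
    simp only [hp, hb, Pi.mul_apply, ← hk, ← hl]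
    ring
  have hE0 : Tendsto (fun x => E x * φ x 0) atTop (𝓝 1) := by
    have := tendsto_pi_nhds.1 hφ.2 0
    simpa [expSigma3, eigY, sigma3, potQ, hE] using this
  have hE1 : Tendsto (fun x => E x * φ x 1) atTop (𝓝 (-(starRingEnd ℂ v / z))) := by
    have := tendsto_pi_nhds.1 hφ.2 1
    simpa [expSigma3, eigY, sigma3, potQ, hE, div_eq_inv_mul] using this
  have hsl : Tendsto s atTop (𝓝 (starRingEnd ℂ v / z)) :=
    ((continuous_conj.tendsto v).comp hlim).div_const z
  have hBl : Tendsto B atTop (𝓝 (v / (2 * lam))) := hlim.div_const _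
  -- The normalisation `(1, -v̄/z)` is annihilated in the limit by the combination `φ₂ + sφ₁`, so
  -- `(a, b)` tends to `(1, 0)`.
  have hψl : Tendsto (fun x => E x * ψ x) atTop (𝓝 0) := by
    have := hE1.add (hsl.mul hE0)
    rw [mul_one, neg_add_cancel] at this
    refine this.congr fun x => ?_
    simp only [hψ]
    ring
  have hχl : Tendsto (fun x => E x * χ x) atTop (𝓝 1) := by
    have := hE0.sub (hBl.mul hψl)
    rw [mul_zero, sub_zero] at this
    refine this.congr fun x => ?_
    simp only [hχ]
    ring
  have key := fun x => norm_sub_one_le_of_perturbation (μ := 2 * I * (k * lam))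
    (β := fun x => β x / ‖z‖) (by simp [mul_assoc] at him ⊢; linarith)
    (hβi.div_const _) (fun x => div_nonneg (hβ0 x) hz0.le) had hbd
    (fun x => by
      rw [norm_mul, hNn, one_mul, han, hbn]
      obtain ⟨-, h2, h3, h4⟩ := hcoef x
      rw [hqn] at h2 h3 h4
      refine (norm_mul_add_mul_le h3 h4 _ _).trans (mul_le_mul_of_nonneg_right ?_
        (le_max_of_le_left (norm_nonneg _)))
      rw [← add_div]
      exact div_le_div_of_nonneg_right (le_add_of_nonneg_right (by positivity)) hz0.le)
    (fun x => by
      rw [norm_mul, hNn', one_mul, han, hbn]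
      obtain ⟨-, h2, h3, h4⟩ := hcoef x
      rw [hqn] at h2 h3 h4
      rw [← norm_neg] at h3
      rw [max_comm]
      refine (norm_mul_add_mul_le h3 h2 _ _).trans ?_
      refine mul_le_mul_of_nonneg_right ?_ (le_max_of_le_left (norm_nonneg _))
      rw [← add_div]
      refine div_le_div_of_nonneg_right (add_le_add (le_add_of_nonneg_right ?_) le_rfl) hz0.le
      positivity)
    (by simpa using (hNl I).mul hχl)
    (by have := (hNl (-I)).mul hψl; rwa [mul_zero] at this)
    (by rw [integral_div, div_le_div_iff₀ hz0 two_pos]; linarith) x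
  intro x
  obtain ⟨k1, k2⟩ := key x
  rw [integral_div] at k1 k2
  obtain ⟨hB1, -⟩ := hcoef x
  have hb2 : ‖E x * ψ x‖ ≤ 2 * J / ‖z‖ := by
    rw [← hbn]
    exact k2.trans_eq (by rw [mul_div_assoc])
  have m1 : ‖E x * φ x 0 - exp (-(I * (N x : ℂ)))‖ ≤ 2 * J * (1 + 2 * K) / ‖z‖ := by
    have h1 : E x * φ x 0 - exp (-(I * (N x : ℂ)))
        = exp (-I * (N x : ℂ)) * (a x - 1) + B x * (E x * ψ x) := by
      simp only [ha, mul_sub, ← mul_assoc, hNN, hχ]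
      rw [neg_mul]
      ring
    rw [h1]
    refine (norm_add_le _ _).trans ?_
    rw [norm_mul, hNn', one_mul, norm_mul]
    have hB2 : ‖B x‖ ≤ 2 * K := hB1.trans (div_le_self (by positivity) hz1)
    calc _ ≤ 2 * (J / ‖z‖) + 2 * K * (2 * J / ‖z‖) := by gcongr
      _ = _ := by ring
  have m2 : ‖E x * φ x 1‖ ≤ (2 * J + K * (1 + 2 * J * (1 + 2 * K))) / ‖z‖ := by
    have h1 : E x * φ x 1 = E x * ψ x - s x * (E x * φ x 0) := by
      simp only [hψ]
      ring
    have h2 : ‖E x * φ x 0‖ ≤ 1 + 2 * J * (1 + 2 * K) := by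
      calc _ = ‖exp (-(I * (N x : ℂ))) + (E x * φ x 0 - exp (-(I * (N x : ℂ))))‖ := by
            rw [add_sub_cancel]
        _ ≤ 1 + 2 * J * (1 + 2 * K) / ‖z‖ := by
            refine (norm_add_le _ _).trans (add_le_add ?_ m1)
            rw [norm_exp_neg_I_mul_ofReal]
        _ ≤ _ := by gcongr; exact div_le_self hJK hz1
    have h3 : ‖s x‖ ≤ K / ‖z‖ := by
      simp only [hs]
      rw [norm_div, RCLike.norm_conj]
      exact div_le_div_of_nonneg_right (huK x) hz0.le
    rw [h1]
    refine (norm_sub_le _ _).trans ?_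
    rw [norm_mul (s x)]
    calc _ ≤ 2 * J / ‖z‖ + K / ‖z‖ * (1 + 2 * J * (1 + 2 * K)) := by gcongr
      _ = _ := by ring
  exact ⟨m1.trans (div_le_div_of_nonneg_right (by linarith) hz0.le),
    m2.trans (div_le_div_of_nonneg_right (by linarith) hz0.le)⟩

end Estimate

/-! ### Symmetries of the spatial equation and of the Jost columns. -/

section Symmetry

variable {α u₀ t : ℝ} {z : ℂ} {u : ℝ → ℝ → ℂ} {v : ℂ} {l : Filter ℝ} {φ : ℝ → Fin 2 → ℂ}

/-- `φ` solves the spatial part of the Lax pair with potential `w`, in components. -/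
def IsLaxSolution (α u₀ : ℝ) (z : ℂ) (w : ℝ → ℂ) (φ : ℝ → Fin 2 → ℂ) : Prop :=
  ∀ x, HasDerivAt (fun x => φ x 0)
      (-(I * α * specK α u₀ z ^ 2) * φ x 0 + I * specK α u₀ z * w x * φ x 1) x ∧
    HasDerivAt (fun x => φ x 1)
      (I * specK α u₀ z * starRingEnd ℂ (w x) * φ x 0 + I * α * specK α u₀ z ^ 2 * φ x 1) x

theorem isLaxSolution_iff {w : ℝ → ℂ} :
    IsLaxSolution α u₀ z w φ ↔ ∀ x, HasDerivAt φ (laxX α u₀ z (w x) *ᵥ φ x) x := by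
  refine forall_congr' fun x => ?_
  rw [hasDerivAt_pi, Fin.forall_fin_two]
  have e0 : (laxX α u₀ z (w x) *ᵥ φ x) 0
      = -(I * α * specK α u₀ z ^ 2) * φ x 0 + I * specK α u₀ z * w x * φ x 1 := by
    simp [laxX, potQ, sigma3, Matrix.mulVec, dotProduct, Fin.sum_univ_two]
  have e1 : (laxX α u₀ z (w x) *ᵥ φ x) 1 = I * specK α u₀ z * starRingEnd ℂ (w x) * φ x 0
      + I * α * specK α u₀ z ^ 2 * φ x 1 := by
    simp [laxX, potQ, sigma3, Matrix.mulVec, dotProduct, Fin.sum_univ_two]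
  rw [e0, e1]

theorem isJostColumn_zero_iff : IsJostColumn l v α u₀ u 0 t z φ ↔
    IsLaxSolution α u₀ z (fun x => u x t) φ ∧
      Tendsto (fun x => exp (-(I * phase α u₀ x t z)) * φ x 0) l (𝓝 1) ∧
      Tendsto (fun x => exp (-(I * phase α u₀ x t z)) * φ x 1) l (𝓝 (-(z⁻¹ * starRingEnd ℂ v))) := by
  rw [IsJostColumn, isLaxSolution_iff, tendsto_pi_nhds, Fin.forall_fin_two]
  simp [expSigma3, eigY, sigma3, potQ]

theorem isJostColumn_one_iff : IsJostColumn l v α u₀ u 1 t z φ ↔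
    IsLaxSolution α u₀ z (fun x => u x t) φ ∧
      Tendsto (fun x => exp (I * phase α u₀ x t z) * φ x 0) l (𝓝 (z⁻¹ * v)) ∧
      Tendsto (fun x => exp (I * phase α u₀ x t z) * φ x 1) l (𝓝 1) := by
  rw [IsJostColumn, isLaxSolution_iff, tendsto_pi_nhds, Fin.forall_fin_two]
  simp [expSigma3, eigY, sigma3, potQ]

/-! ### The symmetry `z ↦ -z̄` -/

theorem conj_two : starRingEnd ℂ 2 = 2 := conj_ofReal 2

theorem conj_four : starRingEnd ℂ 4 = 4 := conj_ofReal 4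

theorem specK_neg_conj : specK α u₀ (-starRingEnd ℂ z) = -starRingEnd ℂ (specK α u₀ z) := by
  simp [specK, conj_two]; ring

theorem specLam_neg_conj : specLam u₀ (-starRingEnd ℂ z) = -starRingEnd ℂ (specLam u₀ z) := by
  simp [specLam, conj_two]; ring

theorem phase_neg_conj (x : ℝ) :
    phase α u₀ x t (-starRingEnd ℂ z) = starRingEnd ℂ (phase α u₀ x t z) := by
  simp [phase, specK_neg_conj, specLam_neg_conj, conj_two, conj_four]

theorem gam_neg_conj : gam u₀ (-starRingEnd ℂ z) = starRingEnd ℂ (gam u₀ z) := by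
  simp [gam]

/-- The vector function with the conjugate components in exchanged order. -/
def swapConj (φ : ℝ → Fin 2 → ℂ) (x : ℝ) : Fin 2 → ℂ :=
  ![starRingEnd ℂ (φ x 1), starRingEnd ℂ (φ x 0)]

/-- Conjugation replaces `ik` by `-ik̄ = ik(-z̄)`. Exchanging the two components restores the places
of `u` and `ū` and the signs of the diagonal. -/
theorem IsLaxSolution.swapConj {w : ℝ → ℂ} (h : IsLaxSolution α u₀ z w φ) :
    IsLaxSolution α u₀ (-starRingEnd ℂ z) w (swapConj φ) := by
  intro x
  refine ⟨(h x).2.star.congr_deriv ?_, (h x).1.star.congr_deriv ?_⟩ <;>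
  · simp [MNLS.swapConj, specK_neg_conj, ← starRingEnd_apply]
    ring

theorem conj_exp_I_mul (θ : ℂ) : starRingEnd ℂ (exp (I * θ)) = exp (-(I * starRingEnd ℂ θ)) := by
  rw [← exp_conj]; simp

theorem conj_exp_neg_I_mul (θ : ℂ) :
    starRingEnd ℂ (exp (-(I * θ))) = exp (I * starRingEnd ℂ θ) := by
  rw [← exp_conj]; simp

theorem IsJostColumn.swapConj_zero (h : IsJostColumn l v α u₀ u 0 t z φ) :
    IsJostColumn l v α u₀ u 1 t (-starRingEnd ℂ z) (swapConj φ) := by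
  obtain ⟨h1, h2, h3⟩ := isJostColumn_zero_iff.1 h
  refine isJostColumn_one_iff.2 ⟨h1.swapConj, ?_, ?_⟩
  · have := (continuous_conj.tendsto _).comp h3
    simpa [Function.comp_def, swapConj, phase_neg_conj, conj_exp_neg_I_mul, inv_neg] using this
  · have := (continuous_conj.tendsto _).comp h2
    simpa [Function.comp_def, swapConj, phase_neg_conj, conj_exp_neg_I_mul] using this

theorem IsJostColumn.swapConj_one (h : IsJostColumn l v α u₀ u 1 t z φ) :
    IsJostColumn l v α u₀ u 0 t (-starRingEnd ℂ z) (swapConj φ) := by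
  obtain ⟨h1, h2, h3⟩ := isJostColumn_one_iff.1 h
  refine isJostColumn_zero_iff.2 ⟨h1.swapConj, ?_, ?_⟩
  · have := (continuous_conj.tendsto _).comp h3
    simpa [Function.comp_def, swapConj, phase_neg_conj, conj_exp_I_mul] using this
  · have := (continuous_conj.tendsto _).comp h2
    simpa [Function.comp_def, swapConj, phase_neg_conj, conj_exp_I_mul, inv_neg] using this

theorem wronskian_swapConj (φ ψ : ℝ → Fin 2 → ℂ) (x : ℝ) :
    wronskian (swapConj φ x) (swapConj ψ x) = -starRingEnd ℂ (wronskian (φ x) (ψ x)) := by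
  simp [wronskian, swapConj]

/-! ### The symmetry `z ↦ -u₀² / z` -/

theorem specK_inversion (hu₀ : u₀ ≠ 0) : specK α u₀ (-(u₀ ^ 2 / z)) = specK α u₀ z := by
  have : (u₀ : ℂ) ≠ 0 := ofReal_ne_zero.2 hu₀
  by_cases hz : z = 0
  · simp [specK, hz]
  unfold specK
  congr 1
  field_simp
  ring

theorem specLam_inversion (hu₀ : u₀ ≠ 0) : specLam u₀ (-(u₀ ^ 2 / z)) = -specLam u₀ z := by
  have : (u₀ : ℂ) ≠ 0 := ofReal_ne_zero.2 hu₀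
  by_cases hz : z = 0
  · simp [specLam, hz]
  unfold specLam
  field_simp
  ring

theorem phase_inversion (hu₀ : u₀ ≠ 0) (x : ℝ) :
    phase α u₀ x t (-(u₀ ^ 2 / z)) = -phase α u₀ x t z := by
  rw [phase, phase, specK_inversion hu₀, specLam_inversion hu₀]
  ring

theorem gam_inversion (hu₀ : u₀ ≠ 0) (hz : z ≠ 0) :
    gam u₀ (-(u₀ ^ 2 / z)) = z ^ 2 / u₀ ^ 2 * gam u₀ z := by
  have : (u₀ : ℂ) ≠ 0 := ofReal_ne_zero.2 hu₀
  unfold gam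
  field_simp
  ring

/-- `X` depends on `z` only through `k`, which the inversion fixes. -/
theorem IsLaxSolution.inversion {w : ℝ → ℂ} (hu₀ : u₀ ≠ 0) (h : IsLaxSolution α u₀ z w φ) (c : ℂ) :
    IsLaxSolution α u₀ (-(u₀ ^ 2 / z)) w (fun x => c • φ x) := by
  intro x
  refine ⟨((h x).1.const_mul c).congr_deriv ?_, ((h x).2.const_mul c).congr_deriv ?_⟩ <;>
  · simp only [specK_inversion hu₀, Pi.smul_apply, smul_eq_mul]
    ring

/-- The inversion changes the sign of `θ`, hence exchanges the columns. The scalar is the one that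
carries `(1, -v̄/z)` to the second column `(-zv/u₀², 1)` of `Y` at `-u₀²/z`, as `|v| = u₀`. -/
theorem IsJostColumn.inversion_zero (hu₀ : u₀ ≠ 0) (hz : z ≠ 0) (hv : ‖v‖ = u₀)
    (h : IsJostColumn l v α u₀ u 0 t z φ) :
    IsJostColumn l v α u₀ u 1 t (-(u₀ ^ 2 / z)) (fun x => (-(z * v / u₀ ^ 2)) • φ x) := by
  obtain ⟨h1, h2, h3⟩ := isJostColumn_zero_iff.1 h
  have hu₀' : (u₀ : ℂ) ≠ 0 := ofReal_ne_zero.2 hu₀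
  have hvv : v * starRingEnd ℂ v = (u₀ : ℂ) ^ 2 := by rw [mul_conj', hv]
  refine isJostColumn_one_iff.2 ⟨h1.inversion hu₀ _, ?_, ?_⟩
  · convert h2.const_mul (-(z * v / u₀ ^ 2)) using 2
    · simp only [phase_inversion hu₀, Pi.smul_apply, smul_eq_mul]; ring_nf
    · field_simp
  · convert h3.const_mul (-(z * v / u₀ ^ 2)) using 2
    · simp only [phase_inversion hu₀, Pi.smul_apply, smul_eq_mul]; ring_nf
    · field_simp
      rw [hvv]

theorem IsJostColumn.inversion_one (hu₀ : u₀ ≠ 0) (hz : z ≠ 0) (hv : ‖v‖ = u₀)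
    (h : IsJostColumn l v α u₀ u 1 t z φ) :
    IsJostColumn l v α u₀ u 0 t (-(u₀ ^ 2 / z))
      (fun x => (z * starRingEnd ℂ v / u₀ ^ 2) • φ x) := by
  obtain ⟨h1, h2, h3⟩ := isJostColumn_one_iff.1 h
  have hu₀' : (u₀ : ℂ) ≠ 0 := ofReal_ne_zero.2 hu₀
  have hvv : starRingEnd ℂ v * v = (u₀ : ℂ) ^ 2 := by rw [mul_comm, mul_conj', hv]
  refine isJostColumn_zero_iff.2 ⟨h1.inversion hu₀ _, ?_, ?_⟩
  · convert h2.const_mul (z * starRingEnd ℂ v / u₀ ^ 2) using 2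
    · simp only [phase_inversion hu₀, Pi.smul_apply, smul_eq_mul]; ring_nf
    · field_simp
      rw [hvv]
  · convert h3.const_mul (z * starRingEnd ℂ v / u₀ ^ 2) using 2
    · simp only [phase_inversion hu₀, Pi.smul_apply, smul_eq_mul]; ring_nf
    · field_simp

/-! ### The reflection `x ↦ -x` -/

/-- The reflected potential. -/
def reflect (u : ℝ → ℝ → ℂ) (x t : ℝ) : ℂ := -starRingEnd ℂ (u (-x) (-t))

theorem reflect_reflect : reflect (reflect u) = u := by
  funext x t; simp [reflect]

/-- The reflected vector function with components in exchanged order. -/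
def swapNeg (φ : ℝ → Fin 2 → ℂ) (x : ℝ) : Fin 2 → ℂ := ![φ (-x) 1, φ (-x) 0]

/-- The phase is odd in `(x, t)` jointly; this is the reason for reversing time in `reflect`. -/
theorem phase_neg (x : ℝ) : phase α u₀ x (-t) z = -phase α u₀ (-x) t z := by
  simp only [phase]; push_cast; ring

theorem IsLaxSolution.swapNeg (h : IsLaxSolution α u₀ z (fun x => u x t) φ) :
    IsLaxSolution α u₀ z (fun x => reflect u x (-t)) (swapNeg φ) := by
  intro x
  have h0 := (h (-x)).1.scomp x (hasDerivAt_neg x)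
  have h1 := (h (-x)).2.scomp x (hasDerivAt_neg x)
  refine ⟨h1.congr_deriv ?_, h0.congr_deriv ?_⟩ <;>
  · simp [MNLS.swapNeg, reflect]
    ring

theorem IsJostColumn.swapNeg_one {l' : Filter ℝ} (hl : Tendsto Neg.neg l' l)
    (h : IsJostColumn l v α u₀ u 1 t z φ) :
    IsJostColumn l' (-starRingEnd ℂ v) α u₀ (reflect u) 0 (-t) z (swapNeg φ) := by
  obtain ⟨h1, h2, h3⟩ := isJostColumn_one_iff.1 h
  refine isJostColumn_zero_iff.2 ⟨h1.swapNeg, ?_, ?_⟩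
  · simpa [Function.comp_def, swapNeg, phase_neg] using h3.comp hl
  · simpa [Function.comp_def, swapNeg, phase_neg] using h2.comp hl

theorem IsJostColumn.swapNeg_zero {l' : Filter ℝ} (hl : Tendsto Neg.neg l' l)
    (h : IsJostColumn l v α u₀ u 0 t z φ) :
    IsJostColumn l' (-starRingEnd ℂ v) α u₀ (reflect u) 1 (-t) z (swapNeg φ) := by
  obtain ⟨h1, h2, h3⟩ := isJostColumn_zero_iff.1 h
  refine isJostColumn_one_iff.2 ⟨h1.swapNeg, ?_, ?_⟩
  · simpa [Function.comp_def, swapNeg, phase_neg] using h3.comp hl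
  · simpa [Function.comp_def, swapNeg, phase_neg] using h2.comp hl

end Symmetry

/-- The assumptions on the profile of the potential at a fixed time. -/
structure IsProfile (u₀ : ℝ) (um up : ℂ) (w : ℝ → ℂ) : Prop where
  pos : 0 < u₀
  norm_left : ‖um‖ = u₀
  norm_right : ‖up‖ = u₀
  contDiff : ContDiff ℝ 1 w
  tendsto_left : Tendsto w atBot (𝓝 um)
  tendsto_right : Tendsto w atTop (𝓝 up)
  integrableOn_left : IntegrableOn (fun x => w x - um) (Set.Iic 0)
  integrableOn_right : IntegrableOn (fun x => w x - up) (Set.Ici 0)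
  integrable_deriv : Integrable (deriv w)

/-! ### Consequences of the assumptions on the profile. -/

namespace IsProfile

variable {u₀ : ℝ} {um up : ℂ} {w : ℝ → ℂ}

theorem reflect (h : IsProfile u₀ um up w) :
    IsProfile u₀ (-starRingEnd ℂ up) (-starRingEnd ℂ um) fun x => -starRingEnd ℂ (w (-x)) where
  pos := h.pos
  norm_left := by rw [norm_neg, RCLike.norm_conj, h.norm_right]
  norm_right := by rw [norm_neg, RCLike.norm_conj, h.norm_left]
  contDiff := (conjCLE.contDiff.comp (h.contDiff.comp contDiff_neg)).neg
  tendsto_left :=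
    ((continuous_conj.tendsto _).comp (h.tendsto_right.comp tendsto_neg_atBot_atTop)).neg
  tendsto_right :=
    ((continuous_conj.tendsto _).comp (h.tendsto_left.comp tendsto_neg_atTop_atBot)).neg
  integrableOn_left := by
    have h1 : IntegrableOn (fun x => w (-x) - up) (Set.Iic 0) := by
      have := h.integrableOn_right.comp_neg
      simpa using this
    have h2 := (conjCLE.toContinuousLinearMap.integrable_comp h1).neg
    refine h2.congr (Eventually.of_forall fun x => ?_)
    simp; ring
  integrableOn_right := by
    have h1 : IntegrableOn (fun x => w (-x) - um) (Set.Ici 0) := by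
      have := h.integrableOn_left.comp_neg
      simpa using this
    have h2 := (conjCLE.toContinuousLinearMap.integrable_comp h1).neg
    refine h2.congr (Eventually.of_forall fun x => ?_)
    simp; ring
  integrable_deriv := by
    have h1 := conjCLE.toContinuousLinearMap.integrable_comp h.integrable_deriv.comp_neg
    refine h1.congr (Eventually.of_forall fun x => ?_)
    have h2 := ((((h.contDiff.differentiable one_ne_zero (-x)).hasDerivAt).scomp x
      (hasDerivAt_neg x)).star).neg
    refine Eq.trans ?_ h2.deriv.symm
    simp [← starRingEnd_apply]

theorem exists_bound (h : IsProfile u₀ um up w) : ∃ K, ∀ x, ‖w x‖ ≤ K := by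
  obtain ⟨K, hK⟩ := bddAbove_norm_Ici h.contDiff.continuous h.tendsto_right 0
  obtain ⟨L, hL⟩ := bddAbove_norm_Ici (h.contDiff.continuous.comp continuous_neg)
    (h.tendsto_left.comp tendsto_neg_atTop_atBot) 0
  refine ⟨max K L, fun x => ?_⟩
  rcases le_total 0 x with hx | hx
  · exact (hK x hx).trans (le_max_left _ _)
  · have := hL (-x) (by linarith)
    simp only [Function.comp_apply, neg_neg] at this
    exact this.trans (le_max_right _ _)

/-- On each half-line `u₀² - |w|² = (u₀ + |w|)(|v| - |w|)`, where `v` is the boundary value there.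
The first factor is bounded, and the second is at most `|w - v|`. -/
theorem integrable_sq_sub_norm_sq (h : IsProfile u₀ um up w) :
    Integrable fun y => u₀ ^ 2 - ‖w y‖ ^ 2 := by
  obtain ⟨K, hK⟩ := h.exists_bound
  have hc : Continuous fun y => u₀ ^ 2 - ‖w y‖ ^ 2 := by
    have := h.contDiff.continuous
    fun_prop
  have key : ∀ (v : ℂ) (s : Set ℝ), ‖v‖ = u₀ → IntegrableOn (fun x => w x - v) s →
      IntegrableOn (fun y => u₀ ^ 2 - ‖w y‖ ^ 2) s := fun v s hv hs => by
    refine Integrable.mono' (hs.norm.const_mul (u₀ + K)) hc.aestronglyMeasurable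
      (Eventually.of_forall fun x => ?_)
    have h1 : u₀ ^ 2 - ‖w x‖ ^ 2 = (u₀ + ‖w x‖) * (‖v‖ - ‖w x‖) := by rw [hv]; ring
    have h2 : |‖v‖ - ‖w x‖| ≤ ‖w x - v‖ := by
      rw [norm_sub_rev]; exact abs_norm_sub_norm_le v (w x)
    have h3 := h.pos
    rw [h1, Real.norm_eq_abs, abs_mul, abs_of_nonneg (add_nonneg h3.le (norm_nonneg _))]
    exact mul_le_mul (by linarith [hK x]) h2 (abs_nonneg _)
      (by linarith [(norm_nonneg _).trans (hK x)])
  have := (key um _ h.norm_left h.integrableOn_left).union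
    (key up _ h.norm_right h.integrableOn_right)
  rwa [Set.Iic_union_Ici, integrableOn_univ] at this

end IsProfile

/-! ### Jost columns and their Wronskians for large `z`. -/

section Asymptotics

variable {α u₀ t : ℝ} {z : ℂ} {u : ℝ → ℝ → ℂ} {um up : ℂ}

/-- `(1 / 2α) ∫₋∞ˣ (u₀² - |u|²) dy`. -/
noncomputable def headPhase (α u₀ : ℝ) (u : ℝ → ℝ → ℂ) (t x : ℝ) : ℝ :=
  1 / (2 * α) * ∫ y in Set.Iic x, (u₀ ^ 2 - ‖u y t‖ ^ 2)

theorem headPhase_add_tailPhase (h : IsProfile u₀ um up fun x => u x t) (x : ℝ) :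
    headPhase α u₀ u t x + tailPhase α u₀ u t x = nu0 α u₀ u t := by
  have hi := h.integrable_sq_sub_norm_sq
  rw [headPhase, tailPhase, nu0, ← mul_add,
    intervalIntegral.integral_Iic_add_Ioi hi.integrableOn hi.integrableOn]

theorem tailPhase_reflect (x : ℝ) :
    tailPhase α u₀ (reflect u) (-t) x = headPhase α u₀ u t (-x) := by
  rw [tailPhase, headPhase, ← integral_comp_neg_Ioi]
  simp [reflect]

theorem IsProfile.reflect_neg (h : IsProfile u₀ um up fun x => u x t) :
    IsProfile u₀ (-starRingEnd ℂ up) (-starRingEnd ℂ um) fun x => MNLS.reflect u x (-t) := by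
  simpa [MNLS.reflect] using h.reflect

theorem neg_conj_neg_conj (z : ℂ) : -starRingEnd ℂ (-starRingEnd ℂ z) = z := by simp

theorem im_mul_neg_conj : (specK α u₀ (-starRingEnd ℂ z) * specLam u₀ (-starRingEnd ℂ z)).im
    = -(specK α u₀ z * specLam u₀ z).im := by
  rw [specK_neg_conj, specLam_neg_conj, neg_mul_neg, ← map_mul, conj_im]

/-! ### Existence of the Jost columns -/

theorem IsProfile.exists_top_zero (h : IsProfile u₀ um up fun x => u x t) (hα : 0 < α)
    (hz : z ≠ 0) (hlam : specLam u₀ z ≠ 0) (him : (specK α u₀ z * specLam u₀ z).im ≤ 0) :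
    ∃ φ, IsJostColumn atTop up α u₀ u 0 t z φ :=
  exists_isJostColumn_atTop_zero hα.ne' h.norm_right h.contDiff.continuous h.integrableOn_right
    hz hlam him

theorem IsProfile.exists_bot_one (h : IsProfile u₀ um up fun x => u x t) (hα : 0 < α)
    (hz : z ≠ 0) (hlam : specLam u₀ z ≠ 0) (him : (specK α u₀ z * specLam u₀ z).im ≤ 0) :
    ∃ φ, IsJostColumn atBot um α u₀ u 1 t z φ := by
  obtain ⟨φ, hφ⟩ := h.reflect_neg.exists_top_zero hα hz hlam him
  have := hφ.swapNeg_zero tendsto_neg_atBot_atTop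
  rw [reflect_reflect, neg_conj_neg_conj, neg_neg] at this
  exact ⟨_, this⟩

theorem IsProfile.exists_top_one (h : IsProfile u₀ um up fun x => u x t) (hα : 0 < α)
    (hz : z ≠ 0) (hlam : specLam u₀ z ≠ 0) (him : 0 ≤ (specK α u₀ z * specLam u₀ z).im) :
    ∃ φ, IsJostColumn atTop up α u₀ u 1 t z φ := by
  obtain ⟨φ, hφ⟩ := h.exists_top_zero (z := -starRingEnd ℂ z) hα (by simpa using hz)
    (by simpa [specLam_neg_conj] using hlam) (by rw [im_mul_neg_conj]; linarith)
  have := hφ.swapConj_zero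
  rw [neg_conj_neg_conj] at this
  exact ⟨_, this⟩

theorem IsProfile.exists_bot_zero (h : IsProfile u₀ um up fun x => u x t) (hα : 0 < α)
    (hz : z ≠ 0) (hlam : specLam u₀ z ≠ 0) (him : 0 ≤ (specK α u₀ z * specLam u₀ z).im) :
    ∃ φ, IsJostColumn atBot um α u₀ u 0 t z φ := by
  obtain ⟨φ, hφ⟩ := h.exists_bot_one (z := -starRingEnd ℂ z) hα (by simpa using hz)
    (by simpa [specLam_neg_conj] using hlam) (by rw [im_mul_neg_conj]; linarith)
  have := hφ.swapConj_one
  rw [neg_conj_neg_conj] at this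
  exact ⟨_, this⟩

theorem isJostColumn_jostColumn {l : Filter ℝ} {v : ℂ} {j : Fin 2}
    (h : ∃ φ, IsJostColumn l v α u₀ u j t z φ) :
    IsJostColumn l v α u₀ u j t z fun x => jostColumn l v α u₀ u j x t z := by
  have : (fun x => jostColumn l v α u₀ u j x t z) = h.choose := by
    funext x; rw [jostColumn, dif_pos h]
  rw [this]
  exact h.choose_spec

/-! ### The Jost columns for large `z` -/

theorem IsProfile.exists_top_zero_le (h : IsProfile u₀ um up fun x => u x t) (hα : 0 < α) :
    ∃ C, ∀ z, C ≤ ‖z‖ → (specK α u₀ z * specLam u₀ z).im ≤ 0 → ∀ φ,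
      IsJostColumn atTop up α u₀ u 0 t z φ → ∀ x,
      ‖exp (-(I * phase α u₀ x t z)) * φ x 0 - exp (-(I * tailPhase α u₀ u t x))‖ ≤ C / ‖z‖ ∧
      ‖exp (-(I * phase α u₀ x t z)) * φ x 1‖ ≤ C / ‖z‖ := by
  obtain ⟨K, hK⟩ := h.exists_bound
  exact exists_norm_isJostColumn_atTop_zero_le hα h.pos h.contDiff hK h.tendsto_right
    h.integrable_sq_sub_norm_sq h.integrable_deriv

theorem IsProfile.exists_bot_one_le (h : IsProfile u₀ um up fun x => u x t) (hα : 0 < α) :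
    ∃ C, ∀ z, C ≤ ‖z‖ → (specK α u₀ z * specLam u₀ z).im ≤ 0 → ∀ φ,
      IsJostColumn atBot um α u₀ u 1 t z φ → ∀ x,
      ‖exp (I * phase α u₀ x t z) * φ x 1 - exp (-(I * headPhase α u₀ u t x))‖ ≤ C / ‖z‖ ∧
      ‖exp (I * phase α u₀ x t z) * φ x 0‖ ≤ C / ‖z‖ := by
  obtain ⟨C, hC⟩ := h.reflect_neg.exists_top_zero_le hα
  refine ⟨C, fun z hz him φ hφ x => ?_⟩
  have := hC z hz him _ (hφ.swapNeg_one tendsto_neg_atTop_atBot) (-x)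
  simpa [phase_neg, tailPhase_reflect, swapNeg] using this

theorem IsProfile.exists_bot_zero_le (h : IsProfile u₀ um up fun x => u x t) (hα : 0 < α) :
    ∃ C, ∀ z, C ≤ ‖z‖ → 0 ≤ (specK α u₀ z * specLam u₀ z).im → ∀ φ,
      IsJostColumn atBot um α u₀ u 0 t z φ → ∀ x,
      ‖exp (-(I * phase α u₀ x t z)) * φ x 0 - exp (I * headPhase α u₀ u t x)‖ ≤ C / ‖z‖ ∧
      ‖exp (-(I * phase α u₀ x t z)) * φ x 1‖ ≤ C / ‖z‖ := by
  obtain ⟨C, hC⟩ := h.exists_bot_one_le hα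
  refine ⟨C, fun z hz him φ hφ x => ?_⟩
  have := hC (-starRingEnd ℂ z) (by simpa using hz) (by rw [im_mul_neg_conj]; linarith) _
    hφ.swapConj_zero x
  rw [norm_neg, RCLike.norm_conj, phase_neg_conj, ← conj_exp_neg_I_mul] at this
  have h2 : exp (-(I * (headPhase α u₀ u t x : ℂ)))
      = starRingEnd ℂ (exp (I * headPhase α u₀ u t x)) := by
    rw [conj_exp_I_mul, conj_ofReal]
  rw [h2] at this
  simp only [swapConj, cons_val_zero, cons_val_one, cons_val_fin_one, ← map_mul, ← map_sub,
    RCLike.norm_conj] at this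
  exact this

theorem norm_exp_I_mul_of_conj_eq {θ : ℂ} (h : starRingEnd ℂ θ = θ) : ‖exp (I * θ)‖ = 1 := by
  rw [← conj_eq_iff_re.1 h, norm_exp_I_mul_ofReal]

/-- For real `z` every ingredient of `θ` is real. An imaginary `z` is fixed by `z ↦ -z̄`, which
conjugates `θ`. -/
theorem conj_phase_of_mem_contour (hz : z ∈ contour) (x : ℝ) :
    starRingEnd ℂ (phase α u₀ x t z) = phase α u₀ x t z := by
  rcases mul_eq_zero.1 hz.1 with h | h
  · have : -starRingEnd ℂ z = z := by
      apply Complex.ext <;> simp [h]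
    rw [← phase_neg_conj, this]
  · have : starRingEnd ℂ z = z := conj_eq_iff_im.2 h
    simp [phase, specK, specLam, this, conj_two, conj_four]

theorem im_mul_of_mem_contour (hz : z ∈ contour) : (specK α u₀ z * specLam u₀ z).im = 0 := by
  rw [im_specK_mul_specLam hz.2, hz.1, zero_mul]

theorem neg_conj_mem_contour (hz : z ∈ contour) : -starRingEnd ℂ z ∈ contour := by
  refine ⟨?_, by simpa using hz.2⟩
  simpa using hz.1

/-! ### Wronskians of the Jost columns for large `z` -/

theorem norm_gam_sub_one_le (hu₀ : 0 ≤ u₀) (h : 2 * u₀ ≤ ‖z‖) (hz : 1 ≤ ‖z‖) :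
    ‖gam u₀ z - 1‖ ≤ u₀ ^ 2 / ‖z‖ ∧ 1 / 2 ≤ ‖gam u₀ z‖ := by
  have h1 : ‖gam u₀ z - 1‖ = u₀ ^ 2 / ‖z‖ ^ 2 := by
    rw [gam, add_sub_cancel_left, norm_div, norm_pow, norm_pow, norm_real,
      Real.norm_of_nonneg hu₀]
  have h2 : u₀ ^ 2 / ‖z‖ ^ 2 ≤ 1 / 2 := by
    rw [div_le_div_iff₀ (by positivity) two_pos]
    nlinarith
  have h3 : u₀ ^ 2 / ‖z‖ ^ 2 ≤ u₀ ^ 2 / ‖z‖ := by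
    gcongr
    nlinarith
  refine ⟨h1.trans_le h3, ?_⟩
  have h4 := norm_sub_norm_le 1 (1 - gam u₀ z)
  rw [norm_sub_rev 1, h1, sub_sub_cancel, norm_one] at h4
  linarith

/-- Dividing by `γ` does not change the leading term. -/
theorem norm_div_gam_sub_le (hu₀ : 0 ≤ u₀) (h : 2 * u₀ ≤ ‖z‖) (hz : 1 ≤ ‖z‖) {W L : ℂ} {C : ℝ}
    (hW : ‖W - L‖ ≤ C / ‖z‖) (hL : ‖L‖ ≤ 1) : ‖W / gam u₀ z - L‖ ≤ 2 * (C + u₀ ^ 2) / ‖z‖ := by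
  obtain ⟨h1, h2⟩ := norm_gam_sub_one_le hu₀ h hz
  have h0 : gam u₀ z ≠ 0 := norm_pos_iff.1 (by linarith)
  have h3 : W / gam u₀ z - L = ((W - L) - L * (gam u₀ z - 1)) / gam u₀ z := by
    field_simp
    ring
  have h4 : ‖(W - L) - L * (gam u₀ z - 1)‖ ≤ (C + u₀ ^ 2) / ‖z‖ := by
    refine (norm_sub_le _ _).trans ?_
    rw [add_div, norm_mul]
    refine add_le_add hW (le_trans ?_ h1)
    exact mul_le_of_le_one_left (norm_nonneg _) hL
  rw [h3, norm_div, div_le_iff₀ (by linarith)]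
  have h5 : 0 ≤ (C + u₀ ^ 2) / ‖z‖ := (norm_nonneg _).trans h4
  calc _ ≤ (C + u₀ ^ 2) / ‖z‖ := h4
    _ ≤ 2 * ((C + u₀ ^ 2) / ‖z‖) * ‖gam u₀ z‖ := by nlinarith
    _ = _ := by ring

theorem norm_mul_sub_mul_sub_le {A B P Q a p : ℂ} {ε : ℝ} (hε : ε ≤ 1) (hA : ‖A - a‖ ≤ ε)
    (hB : ‖B‖ ≤ ε) (hP : ‖P - p‖ ≤ ε) (hQ : ‖Q‖ ≤ ε) (ha : ‖a‖ = 1) (hp : ‖p‖ = 1) :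
    ‖A * P - B * Q - a * p‖ ≤ 4 * ε := by
  have hε0 : 0 ≤ ε := (norm_nonneg _).trans hB
  have h1 : A * P - B * Q - a * p = (A - a) * (P - p) + (A - a) * p + a * (P - p) - B * Q := by
    ring
  rw [h1]
  refine (norm_sub_le _ _).trans ((add_le_add ((norm_add_le _ _).trans
    (add_le_add (norm_add_le _ _) le_rfl)) le_rfl).trans ?_)
  rw [norm_mul, norm_mul, norm_mul, norm_mul, ha, hp]
  have h2 : ‖A - a‖ * ‖P - p‖ ≤ ε * ε := mul_le_mul hA hP (norm_nonneg _) hε0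
  have h3 : ‖B‖ * ‖Q‖ ≤ ε * ε := mul_le_mul hB hQ (norm_nonneg _) hε0
  nlinarith

/-- For off-diagonal entries: after normalisation both columns are close to multiples of the same
basis vector, so their determinant is small. -/
theorem norm_mul_sub_mul_le {A B P Q a p : ℂ} {ε : ℝ} (hε : ε ≤ 1) (hA : ‖A - a‖ ≤ ε)
    (hB : ‖B‖ ≤ ε) (hP : ‖P - p‖ ≤ ε) (hQ : ‖Q‖ ≤ ε) (ha : ‖a‖ = 1) (hp : ‖p‖ = 1) :
    ‖A * Q - B * P‖ ≤ 4 * ε := by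
  have hε0 : 0 ≤ ε := (norm_nonneg _).trans hB
  have hA' : ‖A‖ ≤ 2 := by
    have := norm_sub_norm_le A a
    linarith
  have hP' : ‖P‖ ≤ 2 := by
    have := norm_sub_norm_le P p
    linarith
  refine (norm_sub_le _ _).trans ?_
  rw [norm_mul, norm_mul]
  have h2 : ‖A‖ * ‖Q‖ ≤ 2 * ε := mul_le_mul hA' hQ (norm_nonneg _) two_pos.le
  have h3 : ‖B‖ * ‖P‖ ≤ ε * 2 := mul_le_mul hB hP' (norm_nonneg _) hε0
  linarith

theorem IsProfile.exists_wronskian_top_zero_bot_one_le (h : IsProfile u₀ um up fun x => u x t)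
    (hα : 0 < α) : ∃ C, 1 + 2 * u₀ ≤ C ∧ ∀ z, C ≤ ‖z‖ → (specK α u₀ z * specLam u₀ z).im ≤ 0 →
      ∀ φ ψ, IsJostColumn atTop up α u₀ u 0 t z φ → IsJostColumn atBot um α u₀ u 1 t z ψ → ∀ x,
      ‖wronskian (φ x) (ψ x) / gam u₀ z - exp (-(I * nu0 α u₀ u t))‖ ≤ C / ‖z‖ := by
  obtain ⟨C₁, h₁⟩ := h.exists_top_zero_le hα
  obtain ⟨C₂, h₂⟩ := h.exists_bot_one_le hα
  have hu₀ := h.pos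
  set D := 1 + 2 * u₀ + |C₁| + |C₂| with hD
  have hD1 : C₁ ≤ D := by linarith [le_abs_self C₁, abs_nonneg C₂]
  have hD2 : C₂ ≤ D := by linarith [le_abs_self C₂, abs_nonneg C₁]
  have hD3 : 1 + 2 * u₀ ≤ D := by linarith [abs_nonneg C₂, abs_nonneg C₁]
  -- `4D` bounds the error of the Wronskian itself; `norm_div_gam_sub_le` accounts for the division
  -- by `γ`.
  refine ⟨2 * (4 * D + u₀ ^ 2), by nlinarith, fun z hz him φ ψ hφ hψ x => ?_⟩
  have hzD : D ≤ ‖z‖ := by nlinarith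
  have hz0 : 0 < ‖z‖ := by linarith
  refine norm_div_gam_sub_le hu₀.le (by linarith) (by linarith) ?_
    (norm_exp_neg_I_mul_ofReal _).le
  have hW : wronskian (φ x) (ψ x)
      = (exp (-(I * phase α u₀ x t z)) * φ x 0) * (exp (I * phase α u₀ x t z) * ψ x 1)
        - (exp (-(I * phase α u₀ x t z)) * φ x 1) * (exp (I * phase α u₀ x t z) * ψ x 0) := by
    have hE : exp (-(I * phase α u₀ x t z)) * exp (I * phase α u₀ x t z) = 1 := by
      rw [← exp_add]; simp
    rw [wronskian]
    linear_combination (-(φ x 0 * ψ x 1) + φ x 1 * ψ x 0) * hE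
  -- The head and tail phases depend on `x`, but their sum is always `ν₀`.
  have hL : exp (-(I * (nu0 α u₀ u t : ℂ)))
      = exp (-(I * tailPhase α u₀ u t x)) * exp (-(I * headPhase α u₀ u t x)) := by
    rw [← exp_add, ← headPhase_add_tailPhase h x]
    push_cast
    ring_nf
  obtain ⟨a1, a2⟩ := h₁ z (hD1.trans hzD) him φ hφ x
  obtain ⟨b1, b2⟩ := h₂ z (hD2.trans hzD) him ψ hψ x
  have e1 : C₁ / ‖z‖ ≤ D / ‖z‖ := div_le_div_of_nonneg_right hD1 hz0.le
  have e2 : C₂ / ‖z‖ ≤ D / ‖z‖ := div_le_div_of_nonneg_right hD2 hz0.le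
  rw [hW, hL, mul_div_assoc]
  exact norm_mul_sub_mul_sub_le ((div_le_one hz0).2 hzD) (a1.trans e1) (a2.trans e1)
    (b1.trans e2) (b2.trans e2) (norm_exp_neg_I_mul_ofReal _) (norm_exp_neg_I_mul_ofReal _)

theorem IsProfile.exists_wronskian_bot_zero_top_zero_le (h : IsProfile u₀ um up fun x => u x t)
    (hα : 0 < α) : ∃ C, 1 + 2 * u₀ ≤ C ∧ ∀ z, C ≤ ‖z‖ → z ∈ contour →
      ∀ φ ψ, IsJostColumn atBot um α u₀ u 0 t z φ → IsJostColumn atTop up α u₀ u 0 t z ψ → ∀ x,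
      ‖wronskian (φ x) (ψ x) / gam u₀ z‖ ≤ C / ‖z‖ := by
  obtain ⟨C₁, h₁⟩ := h.exists_bot_zero_le hα
  obtain ⟨C₂, h₂⟩ := h.exists_top_zero_le hα
  have hu₀ := h.pos
  set D := 1 + 2 * u₀ + |C₁| + |C₂| with hD
  have hD1 : C₁ ≤ D := by linarith [le_abs_self C₁, abs_nonneg C₂]
  have hD2 : C₂ ≤ D := by linarith [le_abs_self C₂, abs_nonneg C₁]
  have hD3 : 1 + 2 * u₀ ≤ D := by linarith [abs_nonneg C₂, abs_nonneg C₁]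
  refine ⟨2 * (4 * D + u₀ ^ 2), by nlinarith, fun z hz hzc φ ψ hφ hψ x => ?_⟩
  have hzD : D ≤ ‖z‖ := by nlinarith
  have hz0 : 0 < ‖z‖ := by linarith
  rw [← sub_zero (wronskian (φ x) (ψ x) / gam u₀ z)]
  refine norm_div_gam_sub_le hu₀.le (by linarith) (by linarith) ?_ (by simp)
  -- Both columns carry the same exponential, so `e^{2iθ}` does not cancel; its modulus is 1 only
  -- because `z` lies on `Σ`.
  have hW : wronskian (φ x) (ψ x)
      = (exp (I * phase α u₀ x t z) * exp (I * phase α u₀ x t z)) *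
        ((exp (-(I * phase α u₀ x t z)) * φ x 0) * (exp (-(I * phase α u₀ x t z)) * ψ x 1)
        - (exp (-(I * phase α u₀ x t z)) * φ x 1) * (exp (-(I * phase α u₀ x t z)) * ψ x 0)) := by
    have hE : exp (-(I * phase α u₀ x t z)) * exp (I * phase α u₀ x t z) = 1 := by
      rw [← exp_add]; simp
    rw [wronskian]
    linear_combination (-(φ x 0 * ψ x 1) + φ x 1 * ψ x 0) *
      (exp (-(I * phase α u₀ x t z)) * exp (I * phase α u₀ x t z) + 1) * hE
  have him := im_mul_of_mem_contour (α := α) (u₀ := u₀) hzc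
  obtain ⟨a1, a2⟩ := h₁ z (hD1.trans hzD) him.ge φ hφ x
  obtain ⟨b1, b2⟩ := h₂ z (hD2.trans hzD) him.le ψ hψ x
  have e1 : C₁ / ‖z‖ ≤ D / ‖z‖ := div_le_div_of_nonneg_right hD1 hz0.le
  have e2 : C₂ / ‖z‖ ≤ D / ‖z‖ := div_le_div_of_nonneg_right hD2 hz0.le
  rw [hW, sub_zero, norm_mul, norm_mul, norm_exp_I_mul_of_conj_eq (conj_phase_of_mem_contour hzc x),
    one_mul, one_mul, mul_div_assoc]
  exact norm_mul_sub_mul_le ((div_le_one hz0).2 hzD) (a1.trans e1) (a2.trans e1)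
    (b1.trans e2) (b2.trans e2) (norm_exp_I_mul_ofReal _) (norm_exp_neg_I_mul_ofReal _)

theorem wronskian_swap (a b : Fin 2 → ℂ) : wronskian a b = -wronskian b a := by
  simp only [wronskian]; ring

theorem wronskian_smul (c d : ℂ) (a b : Fin 2 → ℂ) :
    wronskian (c • a) (d • b) = c * d * wronskian a b := by
  simp only [wronskian, Pi.smul_apply, smul_eq_mul]; ring

/-- The sign produced by exchanging components is compensated by exchanging the order of the
columns. -/
theorem wronskian_swapConj_div_gam (φ ψ : ℝ → Fin 2 → ℂ) (x : ℝ) :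
    wronskian (swapConj ψ x) (swapConj φ x) / gam u₀ (-starRingEnd ℂ z)
      = starRingEnd ℂ (wronskian (φ x) (ψ x) / gam u₀ z) := by
  rw [wronskian_swapConj, gam_neg_conj, wronskian_swap (φ x), map_div₀, map_neg]

theorem IsProfile.exists_wronskian_bot_zero_top_one_le (h : IsProfile u₀ um up fun x => u x t)
    (hα : 0 < α) : ∃ C, 1 + 2 * u₀ ≤ C ∧ ∀ z, C ≤ ‖z‖ → 0 ≤ (specK α u₀ z * specLam u₀ z).im →
      ∀ φ ψ, IsJostColumn atBot um α u₀ u 0 t z φ → IsJostColumn atTop up α u₀ u 1 t z ψ → ∀ x,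
      ‖wronskian (φ x) (ψ x) / gam u₀ z - exp (I * nu0 α u₀ u t)‖ ≤ C / ‖z‖ := by
  obtain ⟨C, hC0, hC⟩ := h.exists_wronskian_top_zero_bot_one_le hα
  refine ⟨C, hC0, fun z hz him φ ψ hφ hψ x => ?_⟩
  have := hC (-starRingEnd ℂ z) (by simpa using hz) (by rw [im_mul_neg_conj]; linarith) _ _
    hψ.swapConj_one hφ.swapConj_zero x
  have h2 : exp (-(I * (nu0 α u₀ u t : ℂ))) = starRingEnd ℂ (exp (I * nu0 α u₀ u t)) := by
    rw [conj_exp_I_mul, conj_ofReal]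
  rwa [wronskian_swapConj_div_gam, h2, ← map_sub, RCLike.norm_conj, norm_neg,
    RCLike.norm_conj] at this

theorem IsProfile.exists_wronskian_top_one_bot_one_le (h : IsProfile u₀ um up fun x => u x t)
    (hα : 0 < α) : ∃ C, 1 + 2 * u₀ ≤ C ∧ ∀ z, C ≤ ‖z‖ → z ∈ contour →
      ∀ φ ψ, IsJostColumn atTop up α u₀ u 1 t z φ → IsJostColumn atBot um α u₀ u 1 t z ψ → ∀ x,
      ‖wronskian (φ x) (ψ x) / gam u₀ z‖ ≤ C / ‖z‖ := by
  obtain ⟨C, hC0, hC⟩ := h.exists_wronskian_bot_zero_top_zero_le hα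
  refine ⟨C, hC0, fun z hz hzc φ ψ hφ hψ x => ?_⟩
  have := hC (-starRingEnd ℂ z) (by simpa using hz) (neg_conj_mem_contour hzc) _ _
    hψ.swapConj_one hφ.swapConj_one x
  rwa [wronskian_swapConj_div_gam, RCLike.norm_conj, norm_neg, RCLike.norm_conj] at this

/-! ### The Wronskian relations under the inversion -/

theorem wronskian_inversion_div_gam (hu₀ : u₀ ≠ 0) (hz : z ≠ 0) (c d : ℂ) (a b : Fin 2 → ℂ) :
    wronskian ((z * c / u₀ ^ 2) • a) ((z * d / u₀ ^ 2) • b) / gam u₀ (-(u₀ ^ 2 / z))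
      = c * d / u₀ ^ 2 * (wronskian a b / gam u₀ z) := by
  have hu₀' : (u₀ : ℂ) ≠ 0 := ofReal_ne_zero.2 hu₀
  rw [wronskian_smul, gam_inversion hu₀ hz]
  -- If `γ` vanishes at `z`, it vanishes at the image too, and both quotients take the default value
  -- 0.
  by_cases hg : gam u₀ z = 0
  · simp [hg]
  field_simp

theorem im_mul_inversion (hu₀ : u₀ ≠ 0) :
    (specK α u₀ (-(u₀ ^ 2 / z)) * specLam u₀ (-(u₀ ^ 2 / z))).im
      = -(specK α u₀ z * specLam u₀ z).im := by
  rw [specK_inversion hu₀, specLam_inversion hu₀, mul_neg, neg_im]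

theorem inversion_mem_contour (hu₀ : u₀ ≠ 0) (hz : z ∈ contour) :
    -((u₀ : ℂ) ^ 2 / z) ∈ contour := by
  have hu₀' : (u₀ : ℂ) ≠ 0 := ofReal_ne_zero.2 hu₀
  refine ⟨?_, neg_ne_zero.2 (div_ne_zero (pow_ne_zero 2 hu₀') hz.2)⟩
  rw [← ofReal_pow, neg_re, neg_im, div_re, div_im]
  simp only [ofReal_re, ofReal_im, zero_mul, zero_div, add_zero, zero_sub]
  linear_combination -(u₀ ^ 2 / normSq z) ^ 2 * hz.1

end Asymptotics

/-! ### Behaviour at the origin, and the scattering matrix. -/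

section Scattering

variable {α u₀ t : ℝ} {z : ℂ} {u : ℝ → ℝ → ℂ} {um up : ℂ}

/-! ### The Wronskians at the origin, in terms of those at infinity -/

/-- The right-hand Wronskian is that of `φ₋,₁` and `φ₊,₂` at `-u₀²/z`, so `s₁₁` near 0 is read off
from `s₂₂` near infinity. The factor `um/up` undoes the two inversion scalars. -/
theorem IsProfile.wronskian_top_zero_bot_one_inversion (h : IsProfile u₀ um up fun x => u x t)
    (hz : z ≠ 0) (a b : Fin 2 → ℂ) :
    wronskian a b / gam u₀ z = um / up *
      (wronskian ((z * starRingEnd ℂ um / u₀ ^ 2) • b) ((-(z * up / u₀ ^ 2)) • a)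
        / gam u₀ (-(u₀ ^ 2 / z))) := by
  have hu₀ : (u₀ : ℂ) ≠ 0 := ofReal_ne_zero.2 h.pos.ne'
  have hp : up ≠ 0 := norm_pos_iff.1 (h.norm_right ▸ h.pos)
  have hmm : um * starRingEnd ℂ um = (u₀ : ℂ) ^ 2 := by rw [mul_conj', h.norm_left]
  have e : -(z * up / (u₀ : ℂ) ^ 2) = z * -up / u₀ ^ 2 := by ring
  rw [e, wronskian_inversion_div_gam h.pos.ne' hz, wronskian_swap b a, neg_div]
  have h2 : um / up * (starRingEnd ℂ um * -up / (u₀ : ℂ) ^ 2) = -1 := by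
    field_simp
    linear_combination -hmm
  linear_combination (wronskian a b / gam u₀ z) * h2

theorem IsProfile.wronskian_bot_zero_top_one_inversion (h : IsProfile u₀ um up fun x => u x t)
    (hz : z ≠ 0) (a b : Fin 2 → ℂ) :
    wronskian a b / gam u₀ z = up / um *
      (wronskian ((z * starRingEnd ℂ up / u₀ ^ 2) • b) ((-(z * um / u₀ ^ 2)) • a)
        / gam u₀ (-(u₀ ^ 2 / z))) := by
  have hu₀ : (u₀ : ℂ) ≠ 0 := ofReal_ne_zero.2 h.pos.ne'
  have hm : um ≠ 0 := norm_pos_iff.1 (h.norm_left ▸ h.pos)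
  have hpp : up * starRingEnd ℂ up = (u₀ : ℂ) ^ 2 := by rw [mul_conj', h.norm_right]
  have e : -(z * um / (u₀ : ℂ) ^ 2) = z * -um / u₀ ^ 2 := by ring
  rw [e, wronskian_inversion_div_gam h.pos.ne' hz, wronskian_swap b a, neg_div]
  have h2 : up / um * (starRingEnd ℂ up * -um / (u₀ : ℂ) ^ 2) = -1 := by
    field_simp
    linear_combination -hpp
  linear_combination (wronskian a b / gam u₀ z) * h2

theorem norm_wronskian_inversion (hu₀ : 0 < u₀) (hz : z ≠ 0) {c d : ℂ} (hc : ‖c‖ = u₀)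
    (hd : ‖d‖ = u₀) (a b : Fin 2 → ℂ) :
    ‖wronskian ((z * c / u₀ ^ 2) • a) ((z * d / u₀ ^ 2) • b) / gam u₀ (-(u₀ ^ 2 / z))‖
      = ‖wronskian b a / gam u₀ z‖ := by
  rw [wronskian_inversion_div_gam hu₀.ne' hz, wronskian_swap a b, norm_mul, norm_div, norm_mul,
    hc, hd, norm_pow, norm_real, Real.norm_of_nonneg hu₀.le, neg_div, norm_neg, ← pow_two,
    div_self (by positivity), one_mul]

theorem neg_smul_inversion (c : ℂ) : -(z * c / (u₀ : ℂ) ^ 2) = z * -c / u₀ ^ 2 := by ring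

theorem IsProfile.exists_wronskian_top_zero_bot_one_le' (h : IsProfile u₀ um up fun x => u x t)
    (hα : 0 < α) : ∃ C, 1 + 2 * u₀ ≤ C ∧ ∀ z : ℂ, z ≠ 0 → C ≤ ‖-((u₀ : ℂ) ^ 2 / z)‖ →
      (specK α u₀ z * specLam u₀ z).im ≤ 0 →
      ∀ φ ψ, IsJostColumn atTop up α u₀ u 0 t z φ → IsJostColumn atBot um α u₀ u 1 t z ψ → ∀ x,
      ‖wronskian (φ x) (ψ x) / gam u₀ z - um / up * exp (I * nu0 α u₀ u t)‖
        ≤ C / ‖-((u₀ : ℂ) ^ 2 / z)‖ := by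
  obtain ⟨C, hC0, hC⟩ := h.exists_wronskian_bot_zero_top_one_le hα
  refine ⟨C, hC0, fun z hz0 hz him φ ψ hφ hψ x => ?_⟩
  have := hC _ hz (by rw [im_mul_inversion h.pos.ne']; linarith) _ _
    (hψ.inversion_one h.pos.ne' hz0 h.norm_left) (hφ.inversion_zero h.pos.ne' hz0 h.norm_right) x
  rw [h.wronskian_top_zero_bot_one_inversion hz0, ← mul_sub, norm_mul, norm_div, h.norm_left,
    h.norm_right, div_self h.pos.ne', one_mul]
  exact this

theorem IsProfile.exists_wronskian_bot_zero_top_one_le' (h : IsProfile u₀ um up fun x => u x t)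
    (hα : 0 < α) : ∃ C, 1 + 2 * u₀ ≤ C ∧ ∀ z : ℂ, z ≠ 0 → C ≤ ‖-((u₀ : ℂ) ^ 2 / z)‖ →
      0 ≤ (specK α u₀ z * specLam u₀ z).im →
      ∀ φ ψ, IsJostColumn atBot um α u₀ u 0 t z φ → IsJostColumn atTop up α u₀ u 1 t z ψ → ∀ x,
      ‖wronskian (φ x) (ψ x) / gam u₀ z - up / um * exp (-(I * nu0 α u₀ u t))‖
        ≤ C / ‖-((u₀ : ℂ) ^ 2 / z)‖ := by
  obtain ⟨C, hC0, hC⟩ := h.exists_wronskian_top_zero_bot_one_le hα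
  refine ⟨C, hC0, fun z hz0 hz him φ ψ hφ hψ x => ?_⟩
  have := hC _ hz (by rw [im_mul_inversion h.pos.ne']; linarith) _ _
    (hψ.inversion_one h.pos.ne' hz0 h.norm_right) (hφ.inversion_zero h.pos.ne' hz0 h.norm_left) x
  rw [h.wronskian_bot_zero_top_one_inversion hz0, ← mul_sub, norm_mul, norm_div, h.norm_left,
    h.norm_right, div_self h.pos.ne', one_mul]
  exact this

theorem IsProfile.exists_wronskian_bot_zero_top_zero_le' (h : IsProfile u₀ um up fun x => u x t)
    (hα : 0 < α) : ∃ C, 1 + 2 * u₀ ≤ C ∧ ∀ z : ℂ, C ≤ ‖-((u₀ : ℂ) ^ 2 / z)‖ → z ∈ contour →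
      ∀ φ ψ, IsJostColumn atBot um α u₀ u 0 t z φ → IsJostColumn atTop up α u₀ u 0 t z ψ → ∀ x,
      ‖wronskian (φ x) (ψ x) / gam u₀ z‖ ≤ C / ‖-((u₀ : ℂ) ^ 2 / z)‖ := by
  obtain ⟨C, hC0, hC⟩ := h.exists_wronskian_top_one_bot_one_le hα
  refine ⟨C, hC0, fun z hz hzc φ ψ hφ hψ x => ?_⟩
  have := hC _ hz (inversion_mem_contour h.pos.ne' hzc) _ _
    (hψ.inversion_zero h.pos.ne' hzc.2 h.norm_right)
    (hφ.inversion_zero h.pos.ne' hzc.2 h.norm_left) x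
  rwa [neg_smul_inversion, neg_smul_inversion, norm_wronskian_inversion h.pos hzc.2
    (by rw [norm_neg, h.norm_right]) (by rw [norm_neg, h.norm_left])] at this

theorem IsProfile.exists_wronskian_top_one_bot_one_le' (h : IsProfile u₀ um up fun x => u x t)
    (hα : 0 < α) : ∃ C, 1 + 2 * u₀ ≤ C ∧ ∀ z : ℂ, C ≤ ‖-((u₀ : ℂ) ^ 2 / z)‖ → z ∈ contour →
      ∀ φ ψ, IsJostColumn atTop up α u₀ u 1 t z φ → IsJostColumn atBot um α u₀ u 1 t z ψ → ∀ x,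
      ‖wronskian (φ x) (ψ x) / gam u₀ z‖ ≤ C / ‖-((u₀ : ℂ) ^ 2 / z)‖ := by
  obtain ⟨C, hC0, hC⟩ := h.exists_wronskian_bot_zero_top_zero_le hα
  refine ⟨C, hC0, fun z hz hzc φ ψ hφ hψ x => ?_⟩
  have := hC _ hz (inversion_mem_contour h.pos.ne' hzc) _ _
    (hψ.inversion_one h.pos.ne' hzc.2 h.norm_left)
    (hφ.inversion_one h.pos.ne' hzc.2 h.norm_right) x
  rwa [norm_wronskian_inversion h.pos hzc.2
    (by rw [RCLike.norm_conj, h.norm_left]) (by rw [RCLike.norm_conj, h.norm_right])] at this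

/-! ### The scattering matrix -/

theorem IsLaxSolution.wronskian_eq {w : ℝ → ℂ} {φ ψ : ℝ → Fin 2 → ℂ}
    (hφ : IsLaxSolution α u₀ z w φ) (hψ : IsLaxSolution α u₀ z w ψ) (x y : ℝ) :
    wronskian (φ x) (ψ x) = wronskian (φ y) (ψ y) := by
  have hd : ∀ x, HasDerivAt (fun x => wronskian (φ x) (ψ x)) 0 x := fun x => by
    refine (((hφ x).1.mul (hψ x).2).sub ((hφ x).2.mul (hψ x).1)).congr_deriv ?_
    ring
  exact is_const_of_deriv_eq_zero (fun x => (hd x).differentiableAt) (fun x => (hd x).deriv) x y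

/-- The Wronskian is constant, the exponentials `e^{±iθ}` cancel in it, and its limit at the end `l`
is `det Y = γ`. -/
theorem IsJostColumn.wronskian_eq_gam {l : Filter ℝ} [l.NeBot] {v : ℂ} {φ ψ : ℝ → Fin 2 → ℂ}
    (hv : ‖v‖ = u₀) (hφ : IsJostColumn l v α u₀ u 0 t z φ) (hψ : IsJostColumn l v α u₀ u 1 t z ψ)
    (x : ℝ) : wronskian (φ x) (ψ x) = gam u₀ z := by
  obtain ⟨h1, h2, h3⟩ := isJostColumn_zero_iff.1 hφ
  obtain ⟨k1, k2, k3⟩ := isJostColumn_one_iff.1 hψ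
  have hvv : v * starRingEnd ℂ v = (u₀ : ℂ) ^ 2 := by rw [mul_conj', hv]
  have hlim := (h2.mul k3).sub (h3.mul k2)
  have e1 : (1 : ℂ) * 1 - -(z⁻¹ * starRingEnd ℂ v) * (z⁻¹ * v) = gam u₀ z := by
    rw [gam, ← hvv]
    ring
  rw [e1] at hlim
  refine tendsto_nhds_unique (tendsto_const_nhds.congr fun y => ?_) hlim
  have hE : exp (-(I * phase α u₀ y t z)) * exp (I * phase α u₀ y t z) = 1 := by
    rw [← exp_add]; simp
  rw [h1.wronskian_eq k1 x y, wronskian]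
  linear_combination (-(φ y 0 * ψ y 1) + φ y 1 * ψ y 0) * hE

theorem gam_eq (hz : z ≠ 0) : gam u₀ z = 2 * specLam u₀ z / z := by
  unfold gam specLam
  field_simp

theorem specLam_ne_zero (hz : z ≠ 0) (h1 : z ≠ I * u₀) (h2 : z ≠ -(I * u₀)) :
    specLam u₀ z ≠ 0 := by
  have h3 : (z - I * u₀) * (z + I * u₀) ≠ 0 :=
    mul_ne_zero (sub_ne_zero.2 h1) fun h => h2 (eq_neg_of_add_eq_zero_left h)
  have h4 : specLam u₀ z = (z - I * u₀) * (z + I * u₀) / (2 * z) := by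
    unfold specLam
    field_simp
    linear_combination (u₀ : ℂ) ^ 2 * I_sq
  rw [h4]
  exact div_ne_zero h3 (mul_ne_zero two_ne_zero hz)

/-- The entries of the scattering matrix as quotients of Wronskians. -/
theorem IsProfile.scatteringMatrix_eq (h : IsProfile u₀ um up fun x => u x t) (hα : 0 < α)
    (hz : z ∈ contour) (hlam : specLam u₀ z ≠ 0) (x : ℝ) :
    scatteringMatrix α u₀ um up u t z =
      !![wronskian (jostColumn atTop up α u₀ u 0 x t z) (jostColumn atBot um α u₀ u 1 x t z),
        wronskian (jostColumn atTop up α u₀ u 1 x t z) (jostColumn atBot um α u₀ u 1 x t z);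
        wronskian (jostColumn atBot um α u₀ u 0 x t z) (jostColumn atTop up α u₀ u 0 x t z),
        wronskian (jostColumn atBot um α u₀ u 0 x t z) (jostColumn atTop up α u₀ u 1 x t z)].map
        (· / gam u₀ z) := by
  have him := im_mul_of_mem_contour (α := α) (u₀ := u₀) hz
  have ha := isJostColumn_jostColumn (h.exists_bot_zero hα hz.2 hlam him.ge)
  have hb := isJostColumn_jostColumn (h.exists_bot_one hα hz.2 hlam him.le)
  have hc := isJostColumn_jostColumn (h.exists_top_zero hα hz.2 hlam him.le)
  have hd := isJostColumn_jostColumn (h.exists_top_one hα hz.2 hlam him.ge)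
  have hab := ha.wronskian_eq_gam h.norm_left hb
  have hg : gam u₀ z ≠ 0 := by
    rw [gam_eq hz.2]
    exact div_ne_zero (mul_ne_zero two_ne_zero hlam) hz.2
  have ha1 := (isJostColumn_zero_iff.1 ha).1
  have hb1 := (isJostColumn_one_iff.1 hb).1
  have hc1 := (isJostColumn_zero_iff.1 hc).1
  have hd1 := (isJostColumn_one_iff.1 hd).1
  -- Cramer's rule. The Wronskians taken at `x` may be moved to any `y`, so a single matrix works on
  -- the whole line.
  have hex : ∃ S : Matrix (Fin 2) (Fin 2) ℂ,
      ∀ x, jost atTop up α u₀ u x t z = jost atBot um α u₀ u x t z * S := by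
    refine ⟨!![wronskian (jostColumn atTop up α u₀ u 0 x t z) (jostColumn atBot um α u₀ u 1 x t z),
        wronskian (jostColumn atTop up α u₀ u 1 x t z) (jostColumn atBot um α u₀ u 1 x t z);
        wronskian (jostColumn atBot um α u₀ u 0 x t z) (jostColumn atTop up α u₀ u 0 x t z),
        wronskian (jostColumn atBot um α u₀ u 0 x t z) (jostColumn atTop up α u₀ u 1 x t z)].map
        (· / gam u₀ z), fun y => ?_⟩
    rw [hc1.wronskian_eq hb1 x y, hd1.wronskian_eq hb1 x y, ha1.wronskian_eq hc1 x y,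
      ha1.wronskian_eq hd1 x y]
    have hy := hab y
    simp only [wronskian] at hy
    ext i j
    fin_cases i <;> fin_cases j <;>
    · simp only [jost, Matrix.mul_apply, Fin.sum_univ_two, wronskian, Matrix.map_apply, of_apply,
        Fin.zero_eta, Fin.mk_one, cons_val_zero, cons_val_one, cons_val_fin_one, cons_val']
      field_simp
      rw [← hy]
      ring
  have hS : ∀ x, jost atTop up α u₀ u x t z
      = jost atBot um α u₀ u x t z * scatteringMatrix α u₀ um up u t z := by
    rw [scatteringMatrix, dif_pos hex]
    exact hex.choose_spec
  -- Uniqueness: inserting this expansion of `φ₊` into the Wronskians with the columns of `φ₋`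
  -- recovers the entries of the chosen matrix, multiplied by `γ ≠ 0`.
  have hent : ∀ i j, jostColumn atTop up α u₀ u j x t z i
      = jostColumn atBot um α u₀ u 0 x t z i * scatteringMatrix α u₀ um up u t z 0 j
        + jostColumn atBot um α u₀ u 1 x t z i * scatteringMatrix α u₀ um up u t z 1 j := by
    intro i j
    have := congrFun (congrFun (hS x) i) j
    simpa [jost, Matrix.mul_apply, Fin.sum_univ_two] using this
  have hx := hab x
  simp only [wronskian] at hx
  ext i j
  fin_cases i <;> fin_cases j <;>
  · simp only [wronskian, Matrix.map_apply, of_apply, Fin.zero_eta, Fin.mk_one, cons_val_zero,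
      cons_val_one, cons_val_fin_one, cons_val']
    rw [eq_div_iff hg, ← hx, hent, hent]
    ring

/-! ### Order symbols -/

theorem isBigO_cobounded {f : ℂ → ℂ} {S : Set ℂ} {C : ℝ}
    (h : ∀ z ∈ S, C ≤ ‖z‖ → ‖f z‖ ≤ C / ‖z‖) :
    f =O[Bornology.cobounded ℂ ⊓ 𝓟 S] fun z => z⁻¹ := by
  refine Asymptotics.IsBigO.of_bound C (eventually_inf_principal.2 ?_)
  filter_upwards [eventually_cobounded_le_norm C] with z hz hzS
  rw [norm_inv, ← div_eq_mul_inv]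
  exact h z hzS hz

theorem isBigO_nhdsWithin_zero {f : ℂ → ℂ} {S : Set ℂ} {C : ℝ} (hu₀ : 0 < u₀) (hC : 0 < C)
    (h0 : (0 : ℂ) ∉ S) (h : ∀ z ∈ S, C ≤ ‖-((u₀ : ℂ) ^ 2 / z)‖ →
      ‖f z‖ ≤ C / ‖-((u₀ : ℂ) ^ 2 / z)‖) :
    f =O[𝓝[S] 0] fun z => z := by
  -- The constant arises from `C / |-u₀²/z| = (C/u₀²)|z|`.
  refine Asymptotics.IsBigO.of_bound (C / u₀ ^ 2) ?_
  have hball : Metric.ball (0 : ℂ) (u₀ ^ 2 / C) ∈ 𝓝[S] (0 : ℂ) :=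
    mem_nhdsWithin_of_mem_nhds (Metric.ball_mem_nhds _ (by positivity))
  filter_upwards [hball, self_mem_nhdsWithin] with z hz hzS
  have hz0 : 0 < ‖z‖ := norm_pos_iff.2 fun e => h0 (e ▸ hzS)
  have e : ‖-((u₀ : ℂ) ^ 2 / z)‖ = u₀ ^ 2 / ‖z‖ := by
    rw [norm_neg, norm_div, norm_pow, norm_real, Real.norm_of_nonneg hu₀.le]
  rw [mem_ball_zero_iff, lt_div_iff₀ hC] at hz
  refine (h z hzS ?_).trans_eq ?_
  · rw [e, le_div_iff₀ hz0]
    linarith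
  · rw [e]
    field_simp

theorem specLam_ne_zero_of_le (hu₀ : 0 < u₀) (h : 1 + 2 * u₀ ≤ ‖z‖) : specLam u₀ z ≠ 0 :=
  norm_pos_iff.1 (by linarith [le_norm_specLam (z := z) hu₀.le (by linarith)])

theorem specLam_ne_zero_of_le_inversion (hu₀ : 0 < u₀)
    (h : 1 + 2 * u₀ ≤ ‖-((u₀ : ℂ) ^ 2 / z)‖) : specLam u₀ z ≠ 0 := by
  have := specLam_ne_zero_of_le hu₀ h
  rwa [specLam_inversion hu₀.ne', neg_ne_zero] at this

theorem of_mem_Dplus_union (hα : 0 < α) (hz : z ∈ Dplus ∪ contour) :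
    z ≠ 0 ∧ (specK α u₀ z * specLam u₀ z).im ≤ 0 := by
  rcases hz with hz | hz
  · have hz0 : z ≠ 0 := by rintro rfl; simp [Dplus] at hz
    refine ⟨hz0, ?_⟩
    rw [im_specK_mul_specLam hz0]
    exact mul_nonpos_of_nonpos_of_nonneg (le_of_lt hz) (by positivity)
  · exact ⟨hz.2, (im_mul_of_mem_contour hz).le⟩

theorem of_mem_Dminus_union (hα : 0 < α) (hz : z ∈ Dminus ∪ contour) :
    z ≠ 0 ∧ 0 ≤ (specK α u₀ z * specLam u₀ z).im := by
  rcases hz with hz | hz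
  · have hz0 : z ≠ 0 := by rintro rfl; simp [Dminus] at hz
    refine ⟨hz0, ?_⟩
    rw [im_specK_mul_specLam hz0]
    exact mul_nonneg (le_of_lt hz) (by positivity)
  · exact ⟨hz.2, (im_mul_of_mem_contour hz).ge⟩

theorem IsProfile.isBigO_s11_cobounded (h : IsProfile u₀ um up fun x => u x t) (hα : 0 < α)
    (x : ℝ) : (fun z => s11 α u₀ um up u x t z - exp (-(I * (nu0 α u₀ u t : ℂ))))
      =O[Bornology.cobounded ℂ ⊓ 𝓟 (Dplus ∪ contour)] fun z => z⁻¹ := by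
  obtain ⟨C, hC0, hC⟩ := h.exists_wronskian_top_zero_bot_one_le hα
  refine isBigO_cobounded (C := C) fun z hzS hz => ?_
  obtain ⟨hz0, him⟩ := of_mem_Dplus_union (u₀ := u₀) hα hzS
  have hlam := specLam_ne_zero_of_le h.pos (hC0.trans hz)
  exact hC z hz him _ _ (isJostColumn_jostColumn (h.exists_top_zero hα hz0 hlam him))
    (isJostColumn_jostColumn (h.exists_bot_one hα hz0 hlam him)) x

theorem IsProfile.isBigO_s22_cobounded (h : IsProfile u₀ um up fun x => u x t) (hα : 0 < α)
    (x : ℝ) : (fun z => s22 α u₀ um up u x t z - exp (I * (nu0 α u₀ u t : ℂ)))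
      =O[Bornology.cobounded ℂ ⊓ 𝓟 (Dminus ∪ contour)] fun z => z⁻¹ := by
  obtain ⟨C, hC0, hC⟩ := h.exists_wronskian_bot_zero_top_one_le hα
  refine isBigO_cobounded (C := C) fun z hzS hz => ?_
  obtain ⟨hz0, him⟩ := of_mem_Dminus_union (u₀ := u₀) hα hzS
  have hlam := specLam_ne_zero_of_le h.pos (hC0.trans hz)
  exact hC z hz him _ _ (isJostColumn_jostColumn (h.exists_bot_zero hα hz0 hlam him))
    (isJostColumn_jostColumn (h.exists_top_one hα hz0 hlam him)) x

theorem IsProfile.isBigO_s11_zero (h : IsProfile u₀ um up fun x => u x t) (hα : 0 < α)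
    (x : ℝ) : (fun z => s11 α u₀ um up u x t z - um / up * exp (I * (nu0 α u₀ u t : ℂ)))
      =O[𝓝[Dplus ∪ contour] 0] fun z => z := by
  obtain ⟨C, hC0, hC⟩ := h.exists_wronskian_top_zero_bot_one_le' hα
  refine isBigO_nhdsWithin_zero (C := C) h.pos (by linarith [h.pos])
    (fun h0 => (of_mem_Dplus_union (u₀ := u₀) hα h0).1 rfl) fun z hzS hz => ?_
  obtain ⟨hz0, him⟩ := of_mem_Dplus_union (u₀ := u₀) hα hzS
  have hlam := specLam_ne_zero_of_le_inversion h.pos (hC0.trans hz)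
  exact hC z hz0 hz him _ _ (isJostColumn_jostColumn (h.exists_top_zero hα hz0 hlam him))
    (isJostColumn_jostColumn (h.exists_bot_one hα hz0 hlam him)) x

theorem IsProfile.isBigO_s22_zero (h : IsProfile u₀ um up fun x => u x t) (hα : 0 < α)
    (x : ℝ) : (fun z => s22 α u₀ um up u x t z - up / um * exp (-(I * (nu0 α u₀ u t : ℂ))))
      =O[𝓝[Dminus ∪ contour] 0] fun z => z := by
  obtain ⟨C, hC0, hC⟩ := h.exists_wronskian_bot_zero_top_one_le' hα
  refine isBigO_nhdsWithin_zero (C := C) h.pos (by linarith [h.pos])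
    (fun h0 => (of_mem_Dminus_union (u₀ := u₀) hα h0).1 rfl) fun z hzS hz => ?_
  obtain ⟨hz0, him⟩ := of_mem_Dminus_union (u₀ := u₀) hα hzS
  have hlam := specLam_ne_zero_of_le_inversion h.pos (hC0.trans hz)
  exact hC z hz0 hz him _ _ (isJostColumn_jostColumn (h.exists_bot_zero hα hz0 hlam him))
    (isJostColumn_jostColumn (h.exists_top_one hα hz0 hlam him)) x

theorem eventually_specLam_ne_zero_cobounded (hu₀ : 0 < u₀) (S : Set ℂ) :
    ∀ᶠ z in Bornology.cobounded ℂ ⊓ 𝓟 S, z ∈ S ∧ specLam u₀ z ≠ 0 := by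
  refine eventually_inf_principal.2 ?_
  filter_upwards [eventually_cobounded_le_norm (1 + 2 * u₀)] with z hz hzS
  exact ⟨hzS, specLam_ne_zero_of_le hu₀ hz⟩

theorem eventually_specLam_ne_zero (hu₀ : 0 < u₀) {S : Set ℂ} (h0 : (0 : ℂ) ∉ S) :
    ∀ᶠ z in 𝓝[S] 0, z ∈ S ∧ specLam u₀ z ≠ 0 := by
  filter_upwards [self_mem_nhdsWithin,
    mem_nhdsWithin_of_mem_nhds (Metric.ball_mem_nhds (0 : ℂ) hu₀)] with z hzS hz
  have hz0 : z ≠ 0 := fun e => h0 (e ▸ hzS)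
  rw [mem_ball_zero_iff] at hz
  refine ⟨hzS, specLam_ne_zero hz0 ?_ ?_⟩ <;>
  · rintro rfl
    simp [abs_of_pos hu₀] at hz

theorem IsProfile.isBigO_scatteringMatrix_cobounded (h : IsProfile u₀ um up fun x => u x t)
    (hα : 0 < α) (i j : Fin 2) :
    (fun z => (scatteringMatrix α u₀ um up u t z - expSigma3 (-(I * (nu0 α u₀ u t : ℂ)))) i j)
      =O[Bornology.cobounded ℂ ⊓ 𝓟 contour] fun z => z⁻¹ := by
  have hev := eventually_specLam_ne_zero_cobounded h.pos contour
  have hle : ∀ D, Bornology.cobounded ℂ ⊓ 𝓟 contour ≤ Bornology.cobounded ℂ ⊓ 𝓟 (D ∪ contour) :=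
    fun D => inf_le_inf_left _ (principal_mono.2 Set.subset_union_right)
  fin_cases i <;> fin_cases j
  -- The base point 0 is arbitrary, since the matrix does not depend on `x`.
  · refine ((h.isBigO_s11_cobounded hα 0).mono (hle _)).congr' ?_ EventuallyEq.rfl
    filter_upwards [hev] with z hz
    simp [h.scatteringMatrix_eq hα hz.1 hz.2 0, s11, expSigma3]
  · obtain ⟨C, hC0, hC⟩ := h.exists_wronskian_top_one_bot_one_le hα
    refine isBigO_cobounded (C := C) fun z hzS hz => ?_
    have hlam := specLam_ne_zero_of_le h.pos (hC0.trans hz)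
    have him := im_mul_of_mem_contour (α := α) (u₀ := u₀) hzS
    have := hC z hz hzS _ _ (isJostColumn_jostColumn (h.exists_top_one hα hzS.2 hlam him.ge))
      (isJostColumn_jostColumn (h.exists_bot_one hα hzS.2 hlam him.le)) 0
    simpa [h.scatteringMatrix_eq hα hzS hlam 0, expSigma3] using this
  · obtain ⟨C, hC0, hC⟩ := h.exists_wronskian_bot_zero_top_zero_le hα
    refine isBigO_cobounded (C := C) fun z hzS hz => ?_
    have hlam := specLam_ne_zero_of_le h.pos (hC0.trans hz)
    have him := im_mul_of_mem_contour (α := α) (u₀ := u₀) hzS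
    have := hC z hz hzS _ _ (isJostColumn_jostColumn (h.exists_bot_zero hα hzS.2 hlam him.ge))
      (isJostColumn_jostColumn (h.exists_top_zero hα hzS.2 hlam him.le)) 0
    simpa [h.scatteringMatrix_eq hα hzS hlam 0, expSigma3] using this
  · refine ((h.isBigO_s22_cobounded hα 0).mono (hle _)).congr' ?_ EventuallyEq.rfl
    filter_upwards [hev] with z hz
    simp [h.scatteringMatrix_eq hα hz.1 hz.2 0, s22, expSigma3]

theorem IsProfile.isBigO_scatteringMatrix_zero (h : IsProfile u₀ um up fun x => u x t)
    (hα : 0 < α) (i j : Fin 2) :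
    (fun z => (scatteringMatrix α u₀ um up u t z
      - !![um / up, 0; 0, up / um] * expSigma3 (I * (nu0 α u₀ u t : ℂ))) i j)
      =O[𝓝[contour] 0] fun z => z := by
  have h0 : (0 : ℂ) ∉ contour := fun h => h.2 rfl
  have hev := eventually_specLam_ne_zero h.pos h0
  have hle : ∀ D, 𝓝[contour] (0 : ℂ) ≤ 𝓝[D ∪ contour] 0 :=
    fun D => nhdsWithin_mono _ Set.subset_union_right
  fin_cases i <;> fin_cases j
  · refine ((h.isBigO_s11_zero hα 0).mono (hle _)).congr' ?_ EventuallyEq.rfl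
    filter_upwards [hev] with z hz
    simp [h.scatteringMatrix_eq hα hz.1 hz.2 0, s11, expSigma3]
  · obtain ⟨C, hC0, hC⟩ := h.exists_wronskian_top_one_bot_one_le' hα
    refine isBigO_nhdsWithin_zero (C := C) h.pos (by linarith [h.pos]) h0 fun z hzS hz => ?_
    have hlam := specLam_ne_zero_of_le_inversion h.pos (hC0.trans hz)
    have him := im_mul_of_mem_contour (α := α) (u₀ := u₀) hzS
    have := hC z hz hzS _ _ (isJostColumn_jostColumn (h.exists_top_one hα hzS.2 hlam him.ge))
      (isJostColumn_jostColumn (h.exists_bot_one hα hzS.2 hlam him.le)) 0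
    simpa [h.scatteringMatrix_eq hα hzS hlam 0, expSigma3] using this
  · obtain ⟨C, hC0, hC⟩ := h.exists_wronskian_bot_zero_top_zero_le' hα
    refine isBigO_nhdsWithin_zero (C := C) h.pos (by linarith [h.pos]) h0 fun z hzS hz => ?_
    have hlam := specLam_ne_zero_of_le_inversion h.pos (hC0.trans hz)
    have him := im_mul_of_mem_contour (α := α) (u₀ := u₀) hzS
    have := hC z hz hzS _ _ (isJostColumn_jostColumn (h.exists_bot_zero hα hzS.2 hlam him.ge))
      (isJostColumn_jostColumn (h.exists_top_zero hα hzS.2 hlam him.le)) 0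
    simpa [h.scatteringMatrix_eq hα hzS hlam 0, expSigma3] using this
  · refine ((h.isBigO_s22_zero hα 0).mono (hle _)).congr' ?_ EventuallyEq.rfl
    filter_upwards [hev] with z hz
    simp [h.scatteringMatrix_eq hα hz.1 hz.2 0, s22, expSigma3]

end Scattering

end MNLS

theorem mainTheorem6 (α u₀ : ℝ) (hα : 0 < α) (hu₀ : 0 < u₀) (um up : ℂ)
    (hum : ‖um‖ = u₀) (hup : ‖up‖ = u₀) (u : ℝ → ℝ → ℂ) (t : ℝ)
    (hsmooth : ContDiff ℝ 1 (fun x => u x t))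
    (hlim_m : Tendsto (fun x => u x t) atBot (𝓝 um))
    (hlim_p : Tendsto (fun x => u x t) atTop (𝓝 up))
    (hint_m : IntegrableOn (fun x => u x t - um) (Set.Iic 0))
    (hint_p : IntegrableOn (fun x => u x t - up) (Set.Ici 0))
    (hint_x : Integrable (deriv fun x => u x t)) :
    -- the integral that defines `ν₀` converges absolutely
    Integrable (fun y : ℝ => u₀ ^ 2 - ‖u y t‖ ^ 2) ∧
    -- the scattering matrix on `Σ`, as `z → ∞` and as `z → 0`
    (∀ i j : Fin 2,
      (fun z => (MNLS.scatteringMatrix α u₀ um up u t z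
          - MNLS.expSigma3 (-(I * (MNLS.nu0 α u₀ u t : ℂ)))) i j)
        =O[Bornology.cobounded ℂ ⊓ 𝓟 MNLS.contour] fun z => z⁻¹) ∧
    (∀ i j : Fin 2,
      (fun z => (MNLS.scatteringMatrix α u₀ um up u t z
          - !![um / up, 0; 0, up / um] * MNLS.expSigma3 (I * (MNLS.nu0 α u₀ u t : ℂ))) i j)
        =O[𝓝[MNLS.contour] 0] fun z => z) ∧
    -- on `Σ` the diagonal entries are the Wronskian quotients `s₁₁`, `s₂₂`
    (∀ x : ℝ, ∀ z ∈ MNLS.contour, z ≠ I * (u₀ : ℂ) → z ≠ -(I * (u₀ : ℂ)) →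
      MNLS.scatteringMatrix α u₀ um up u t z 0 0 = MNLS.s11 α u₀ um up u x t z ∧
      MNLS.scatteringMatrix α u₀ um up u t z 1 1 = MNLS.s22 α u₀ um up u x t z) ∧
    -- the diagonal entries on the full regions where they are defined
    (∀ x : ℝ,
      ((fun z => MNLS.s11 α u₀ um up u x t z - exp (-(I * (MNLS.nu0 α u₀ u t : ℂ))))
        =O[Bornology.cobounded ℂ ⊓ 𝓟 (MNLS.Dplus ∪ MNLS.contour)] fun z => z⁻¹) ∧
      ((fun z => MNLS.s22 α u₀ um up u x t z - exp (I * (MNLS.nu0 α u₀ u t : ℂ)))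
        =O[Bornology.cobounded ℂ ⊓ 𝓟 (MNLS.Dminus ∪ MNLS.contour)] fun z => z⁻¹) ∧
      ((fun z => MNLS.s11 α u₀ um up u x t z
          - um / up * exp (I * (MNLS.nu0 α u₀ u t : ℂ)))
        =O[𝓝[MNLS.Dplus ∪ MNLS.contour] 0] fun z => z) ∧
      ((fun z => MNLS.s22 α u₀ um up u x t z
          - up / um * exp (-(I * (MNLS.nu0 α u₀ u t : ℂ))))
        =O[𝓝[MNLS.Dminus ∪ MNLS.contour] 0] fun z => z)) := by
  have h : MNLS.IsProfile u₀ um up fun x => u x t :=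
    ⟨hu₀, hum, hup, hsmooth, hlim_m, hlim_p, hint_m, hint_p, hint_x⟩
  refine ⟨h.integrable_sq_sub_norm_sq, h.isBigO_scatteringMatrix_cobounded hα,
    h.isBigO_scatteringMatrix_zero hα, fun x z hz h1 h2 => ?_, fun x =>
      ⟨h.isBigO_s11_cobounded hα x, h.isBigO_s22_cobounded hα x, h.isBigO_s11_zero hα x,
        h.isBigO_s22_zero hα x⟩⟩
  rw [h.scatteringMatrix_eq hα hz (MNLS.specLam_ne_zero hz.2 h1 h2) x]
  exact ⟨rfl, rfl⟩
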